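/- **Programs.** A probabilistic program (loop) $P$ has the form $\mathit{init};\ \texttt{while true: } \mathit{body}\ \texttt{end}$, where $\mathit{init}$ and $\mathit{body}$ are finite lists of statements. A statement is a conditioned assignment $x = v\,[C]\,d$ ($x$ gets a value of $v$ if the Boolean condition $C$ holds just before the assignment, and the value of the variable $d$ otherwise; the plain assignment $x=v$ is $x=v\,[\mathit{true}]\,x$), a simultaneous assignment $x_1,\dots,x_l=v_1,\dots,v_l$, or an if-statement (with or without else, possibly nested). A right-hand side $v$ is a categorical expression $v_1\{p_1\}\dots v_k\{p_k\}$ of polynomials with constant probabilities, a draw from $\mathrm{Bernoulli}(p)$, $\mathrm{Normal}(p,v)$, $\mathrm{Uniform}(p_1,p_2)$, $\mathrm{Laplace}(p,b)$, $\mathrm{Exponential}(p)$ or any further parametrized distribution, with polynomials in the program variables as parameters, or a draw from $\mathrm{Exponential}(c/p)$ with a constant $c$ and a polynomial $p$. Constants may contain symbolic constants. $\mathrm{Vars}(P)$ is the set of variables assigned in the loop body. **Semantics.** For given values of the symbolic constants and of the uninitialized variables, the run of $P$ is the Markov chain of states whose initial law is the law of the state after $\mathit{init}$ and whose transition kernel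 is one execution of $\mathit{body}$. $P$ is *admissible* (for these values) if almost surely every executed draw has admissible parameters (probabilities non-negative with sum one, variance $\ge 0$, scale and rate $>0$, $p_1<p_2$ for $\mathrm{Uniform}(p_1,p_2)$, and $c,p>0$ for $\mathrm{Exponential}(c/p)$). Write $P\equiv^X Q$ if $X\subseteq \mathrm{Vars}(P)\cap\mathrm{Vars}(Q)$ and, for all values for which $P$ is admissible, $Q$ is admissible too and the joint law of $(x_n)_{x\in X,\,n\in\mathbb N}$ is the same for $P$ and $Q$ ($x_n$ is the value of $x$ after $n$ iterations). **Transformations.** Each replaces a contiguous part of a statement list of $\mathit{init}$ or $\mathit{body}$ (at any nesting depth); all auxiliary variables $t,t_i$, and $x_1,\dots,x_{l-1}$ in the last item, are distinct and do not occur in the program. - *Simultaneous assignment:* $x_1,\dots,x_l=v_1,\dots,v_l\ \mapsto\ t_1=v_1;\dots;t_l=v_l;\,x_1=t_1;\dots;x_l=t_l$. - *Distribution:* $x=\mathrm{Normal}(p,v)\mapsto t=\mathrm{Normal}(0,v);\,x=p+t$; $\ x=\mathrm{Uniform}(p_1,p_2)\mapsto t=\mathrm{Uniform}(0,1);\,x=p_1+(p_2-p_1)t$;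 $\ x=\mathrm{Laplace}(p,b)\mapsto t=\mathrm{Laplace}(0,b);\,x=p+t$; $\ x=\mathrm{Exponential}(c/p)\mapsto t=\mathrm{Exponential}(c);\,x=p\,t$; in the first three cases only if the draw does not already have the target shape. If the assignment is $x=\dots[C]\,d$, then the result has $t=\dots[C]\,t$ and $x=\dots[C]\,d$. - *Else:* $\texttt{if } C: B_1 \texttt{ else: } B_2\texttt{ end}\ \mapsto\ t_1=y_1;\dots;t_l=y_l;\ \texttt{if } C: B_1\texttt{ end};\ \texttt{if not } C': B_2\texttt{ end}$, where $y_1,\dots,y_l$ are the variables of $C$ that are assigned in $B_1$ and $C'$ is $C$ with every $y_i$ replaced by $t_i$. - *If:* $\texttt{if } C_1: x=v\,[C_2]\,x;\ \mathit{Rest}\texttt{ end}\ \mapsto\ t=x;\ x=v\,[C_1\wedge C_2]\,x;\ \texttt{if } C_1': \mathit{Rest}\texttt{ end}$, where $C_1'$ is $C_1$ with $x$ replaced by $t$; the line $t=x$ is dropped if $x$ does not occur in $C_1$, and the if-statement is dropped if $\mathit{Rest}$ is empty. - *Multi-assignment* ($l\ge2$): $x=v_1[C_1]d_1;\mathit{Rest}_1;\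 x=v_2[C_2]d_2;\mathit{Rest}_2;\ \dots;\ x=v_l[C_l]d_l\ \mapsto\ x_1=v_1[C_1]d_1;\mathit{Rest}_1';\ x_2=v_2'[C_2']d_2';\mathit{Rest}_2';\ \dots;\ x=v_l'[C_l']d_l'$, where in $v_i',C_i',d_i'$ the variable $x$ is replaced by $x_{i-1}$, and in $\mathit{Rest}_i'$ by $x_i$. A program is in *normal form* if none of the transformations is applicable to it. **Theorem 3.1 (Normal Form).** For every probabilistic program $P$ there is a program $P_N$ in normal form with $P\equiv^{\mathrm{Vars}(P)}P_N$. Moreover, $P_N$ is obtained from $P$ by exhaustively applying transformations: no infinite sequence of transformations starts in $P$, in whatever order they are applied; every program $Q$ that is reached from $P$ by transformations satisfies $P\equiv^{\mathrm{Vars}(P)}Q$; and there is an explicit procedure, which applies a transformation to every program that is not in normal form and stops exactly at the normal forms, such that iterating it from $P$ ends after finitely many steps in such a $P_N$. -/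

import Mathlib

/-! Probabilistic loops, their Markov chain semantics, and the five program transformations. -/

open MeasureTheory ProbabilityTheory

namespace ProbLoop

/-- Program variables. -/
abbrev Var := ℕ

/-- Names of symbolic constants. -/
abbrev Sym := ℕ

/-! ### Syntax -/

/-- Constants. Numerals are kept apart from the other real literals, so that being the literal `0`
or `1` is a syntactic (decidable) property. -/
inductive Const : Type where
  | num (n : ℕ)
  | real (r : ℝ)
  | sym (a : Sym)
  | add (c₁ c₂ : Const)
  | mul (c₁ c₂ : Const)
  | div (c₁ c₂ : Const)

/-- Polynomial expressions. -/
inductive Poly : Type where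
  | const (c : Const)
  | var (x : Var)
  | add (p q : Poly)
  | sub (p q : Poly)
  | mul (p q : Poly)
  | pow (p : Poly) (n : ℕ)

/-- Boolean conditions. -/
inductive BExp : Type where
  | tt
  | ff
  | eq (p q : Poly)
  | ne (p q : Poly)
  | lt (p q : Poly)
  | gt (p q : Poly)
  | ge (p q : Poly)
  | le (p q : Poly)
  | not (C : BExp)
  | and (C D : BExp)
  | or (C D : BExp)

/-- Right-hand sides of assignments.
* `cat [(v₁, p₁), …, (vₖ, pₖ)] v p` is the categorical expression `v₁ {p₁} … vₖ {pₖ} v {p}`; the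
  last probability may be omitted (`none`). In particular `cat [] v none` is the expression `v`.
* `expQuot c p` is `Exponential(c/p)`.
* `other k D args` is a draw from any further family `D` of distributions with `k` real parameters,
  given by a Markov kernel from the space of parameters to the reals. -/
inductive Rhs : Type where
  | cat (choices : List (Poly × Const)) (last : Poly) (lastProb : Option Const)
  | bernoulli (p : Poly)
  | normal (mean variance : Poly)
  | uniform (a b : Poly)
  | laplace (location scale : Poly)
  | exponential (rate : Poly)
  | expQuot (c : Const) (p : Poly)
  | other (k : ℕ) (D : {κ : Kernel (Fin k → ℝ) ℝ // IsMarkovKernel κ}) (args : Fin k → Poly)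

/-- Statement lists. `nil` is the empty list, every other constructor puts one statement in front of
the list `rest`:
* `assign x v C d rest`: the conditioned assignment `x = v [C] d`. The plain assignment `x = v` is
  the case where `C` is `true` and `d` is `x`.
* `sim [(x₁, v₁), …, (xₗ, vₗ)] rest`: the simultaneous assignment `x₁, …, xₗ = v₁, …, vₗ`.
* `ifThen C b rest`: `if C: b end`.
* `ifElse C b₁ b₂ rest`: `if C: b₁ else: b₂ end`; `else if` is sugar for a nested `ifElse`. -/
inductive Block : Type where
  | nil
  | assign (x : Var) (v : Rhs) (C : BExp) (d : Var) (rest : Block)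
  | sim (L : List (Var × Rhs)) (rest : Block)
  | ifThen (C : BExp) (b : Block) (rest : Block)
  | ifElse (C : BExp) (b₁ b₂ : Block) (rest : Block)

/-- A probabilistic loop `init; while true: body end`. -/
structure Program : Type where
  init : Block
  body : Block

/-- The literal `0`. -/
def Poly.zero : Poly := .const (.num 0)

/-- The literal `1`. -/
def Poly.one : Poly := .const (.num 1)

/-- Is the expression the literal `0`? -/
def Poly.isZero : Poly → Bool
  | .const (.num 0) => true
  | _ => false

/-- Is the expression the literal `1`? -/
def Poly.isOne : Poly → Bool
  | .const (.num 1) => true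
  | _ => false

/-- A polynomial expression as a right-hand side. -/
def Rhs.ofPoly (p : Poly) : Rhs := .cat [] p none

/-- Concatenation of statement lists. -/
def Block.append : Block → Block → Block
  | .nil, k => k
  | .assign x v C d r, k => .assign x v C d (r.append k)
  | .sim L r, k => .sim L (r.append k)
  | .ifThen C b r, k => .ifThen C b (r.append k)
  | .ifElse C b₁ b₂ r, k => .ifElse C b₁ b₂ (r.append k)

/-- The plain assignments `x₁ = v₁; …; xₗ = vₗ`. -/
def Block.assigns : List (Var × Rhs) → Block
  | [] => .nil
  | (x, v) :: L => .assign x v .tt x (Block.assigns L)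

/-! Occurring variables. -/

/-- Variables of a polynomial expression. -/
def Poly.vars : Poly → Finset Var
  | .const _ => ∅
  | .var x => {x}
  | .add p q => p.vars ∪ q.vars
  | .sub p q => p.vars ∪ q.vars
  | .mul p q => p.vars ∪ q.vars
  | .pow p _ => p.vars

/-- Variables of a condition. -/
def BExp.vars : BExp → Finset Var
  | .tt => ∅
  | .ff => ∅
  | .eq p q => p.vars ∪ q.vars
  | .ne p q => p.vars ∪ q.vars
  | .lt p q => p.vars ∪ q.vars
  | .gt p q => p.vars ∪ q.vars
  | .ge p q => p.vars ∪ q.vars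
  | .le p q => p.vars ∪ q.vars
  | .not C => C.vars
  | .and C D => C.vars ∪ D.vars
  | .or C D => C.vars ∪ D.vars

/-- Variables of a right-hand side. -/
def Rhs.vars : Rhs → Finset Var
  | .cat L p _ => L.foldr (fun c U => c.1.vars ∪ U) p.vars
  | .bernoulli p => p.vars
  | .normal p q => p.vars ∪ q.vars
  | .uniform p q => p.vars ∪ q.vars
  | .laplace p q => p.vars ∪ q.vars
  | .exponential p => p.vars
  | .expQuot _ p => p.vars
  | .other _ _ args => Finset.univ.biUnion fun i => (args i).vars

/-- All variables that occur in a statement list. -/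
def Block.vars : Block → Finset Var
  | .nil => ∅
  | .assign x v C d r => {x, d} ∪ v.vars ∪ C.vars ∪ r.vars
  | .sim L r => L.foldr (fun c U => insert c.1 (c.2.vars ∪ U)) r.vars
  | .ifThen C b r => C.vars ∪ b.vars ∪ r.vars
  | .ifElse C b₁ b₂ r => C.vars ∪ b₁.vars ∪ b₂.vars ∪ r.vars

/-- All variables on the left-hand side of some assignment in a statement list. -/
def Block.assigned : Block → Finset Var
  | .nil => ∅
  | .assign x _ _ _ r => insert x r.assigned
  | .sim L r => L.foldr (fun c U => insert c.1 U) r.assigned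
  | .ifThen _ b r => b.assigned ∪ r.assigned
  | .ifElse _ b₁ b₂ r => b₁.assigned ∪ b₂.assigned ∪ r.assigned

/-- All variables that occur in a program. -/
def Program.allVars (P : Program) : Finset Var := P.init.vars ∪ P.body.vars

/-- `Vars(P)`: the variables on the left-hand side of an assignment in the loop body. -/
def Program.Vars (P : Program) : Finset Var := P.body.assigned

/-! Renaming of variables. -/

/-- Renaming in a polynomial expression. -/
def Poly.rename (f : Var → Var) : Poly → Poly
  | .const c => .const c
  | .var x => .var (f x)
  | .add p q => .add (p.rename f) (q.rename f)
  | .sub p q => .sub (p.rename f) (q.rename f)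
  | .mul p q => .mul (p.rename f) (q.rename f)
  | .pow p n => .pow (p.rename f) n

/-- Renaming in a condition. -/
def BExp.rename (f : Var → Var) : BExp → BExp
  | .tt => .tt
  | .ff => .ff
  | .eq p q => .eq (p.rename f) (q.rename f)
  | .ne p q => .ne (p.rename f) (q.rename f)
  | .lt p q => .lt (p.rename f) (q.rename f)
  | .gt p q => .gt (p.rename f) (q.rename f)
  | .ge p q => .ge (p.rename f) (q.rename f)
  | .le p q => .le (p.rename f) (q.rename f)
  | .not C => .not (C.rename f)
  | .and C D => .and (C.rename f) (D.rename f)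
  | .or C D => .or (C.rename f) (D.rename f)

/-- Renaming in a right-hand side. -/
def Rhs.rename (f : Var → Var) : Rhs → Rhs
  | .cat L p o => .cat (L.map fun c => (c.1.rename f, c.2)) (p.rename f) o
  | .bernoulli p => .bernoulli (p.rename f)
  | .normal p q => .normal (p.rename f) (q.rename f)
  | .uniform p q => .uniform (p.rename f) (q.rename f)
  | .laplace p q => .laplace (p.rename f) (q.rename f)
  | .exponential p => .exponential (p.rename f)
  | .expQuot c p => .expQuot c (p.rename f)
  | .other k D args => .other k D fun i => (args i).rename f

/-- Renaming in a statement list (of read, default and assigned variables). -/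
def Block.rename (f : Var → Var) : Block → Block
  | .nil => .nil
  | .assign x v C d r => .assign (f x) (v.rename f) (C.rename f) (f d) (r.rename f)
  | .sim L r => .sim (L.map fun c => (f c.1, c.2.rename f)) (r.rename f)
  | .ifThen C b r => .ifThen (C.rename f) (b.rename f) (r.rename f)
  | .ifElse C b₁ b₂ r => .ifElse (C.rename f) (b₁.rename f) (b₂.rename f) (r.rename f)

/-- The renaming `x ↦ y`. -/
def sub (x y : Var) : Var → Var := fun z => if z = x then y else z

/-! ### Transformations -/

/-- The distribution transformation on right-hand sides: `x = v` becomes `t = w; x = u` where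
`v.distSplit t = some (w, u)`. It does not apply to draws that already have the target shape
`Normal(0, v)`, `Uniform(0, 1)`, `Laplace(0, b)`. -/
def Rhs.distSplit (t : Var) : Rhs → Option (Rhs × Rhs)
  | .normal p v =>
      if p.isZero then none else some (.normal .zero v, .ofPoly (p.add (.var t)))
  | .uniform p₁ p₂ =>
      if p₁.isZero && p₂.isOne then none
      else some (.uniform .zero .one, .ofPoly (p₁.add ((p₂.sub p₁).mul (.var t))))
  | .laplace p b =>
      if p.isZero then none else some (.laplace .zero b, .ofPoly (p.add (.var t)))
  | .expQuot c p => some (.exponential (.const c), .ofPoly (p.mul (.var t)))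
  | _ => none

/-- Result of the simultaneous assignment transformation with auxiliary variables `ts`:
`t₁ = v₁; …; tₗ = vₗ; x₁ = t₁; …; xₗ = tₗ`. -/
def simNew (ts : List Var) (L : List (Var × Rhs)) : Block :=
  (Block.assigns (ts.zip (L.map Prod.snd))).append
    (Block.assigns ((L.map Prod.fst).zip (ts.map fun t => Rhs.ofPoly (.var t))))

/-- Result of the distribution transformation of `x = v [C] d`, where `v` splits into `w` and `u`.
The condition is carried over to the auxiliary draw, so that nothing is drawn unless `C` holds. -/
def distNew (t x : Var) (w u : Rhs) (C : BExp) (d : Var) : Block :=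
  .assign t w C t (.assign x u C d .nil)

/-- Result of the else transformation, where `xs` lists the variables of `C` that are assigned in
`b₁`, and `t y` is the auxiliary variable of `y`. -/
def elseNew (xs : List Var) (t : Var → Var) (C : BExp) (b₁ b₂ : Block) : Block :=
  (Block.assigns (xs.map fun y => (t y, Rhs.ofPoly (.var y)))).append
    (.ifThen C b₁ (.ifThen (.not (C.rename fun y => if y ∈ xs then t y else y)) b₂ .nil))

/-- Result of the if transformation of `if C₁: x = v [C₂] x; rest end`. -/
def ifNew (t : Var) (C₁ : BExp) (x : Var) (v : Rhs) (C₂ : BExp) (rest : Block) : Block :=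
  let tail : Block := match rest with
    | .nil => .nil
    | r => .ifThen (C₁.rename (sub x t)) r .nil
  let main : Block := .assign x v (.and C₁ C₂) x tail
  if x ∈ C₁.vars then .assign t (.ofPoly (.var x)) .tt t main else main

/-- One assignment `v [C] d` to the variable in question, with the statements `rest` after it. -/
structure Item : Type where
  v : Rhs
  C : BExp
  d : Var
  rest : Block

/-- `x = v₁ [C₁] d₁; Rest₁; …; x = v [C] d` with the last assignment given separately. -/
def multiOld (x : Var) : List Item → Rhs → BExp → Var → Block
  | [], v, C, d => .assign x v C d .nil
  | i :: L, v, C, d => .assign x i.v i.C i.d (i.rest.append (multiOld x L v C d))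

/-- Result of the multi-assignment transformation, where `ys` are the auxiliary variables, and where
`prev` is the variable that currently stands for `x`: the assignments to `x` except for the last
one go to the auxiliary variables, and every reference to `x` is replaced by a reference to the
latest auxiliary variable. -/
def multiNew (x : Var) (prev : Var) : List (Var × Item) → Rhs → BExp → Var → Block
  | [], v, C, d => .assign x (v.rename (sub x prev)) (C.rename (sub x prev)) (sub x prev d) .nil
  | (y, i) :: L, v, C, d =>
      .assign y (i.v.rename (sub x prev)) (i.C.rename (sub x prev)) (sub x prev i.d)
        ((i.rest.rename (sub x y)).append (multiNew x y L v C d))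

/-- `Rule U old new`: one of the five transformations turns `old` into `new`, where the auxiliary
variables are outside of `U`. -/
inductive Rule (U : Finset Var) : Block → Block → Prop where
  /-- Simultaneous assignment transformation. -/
  | sim (L : List (Var × Rhs)) (ts : List Var) (hlen : ts.length = L.length) (hnd : ts.Nodup)
      (hfr : ∀ t ∈ ts, t ∉ U) : Rule U (.sim L .nil) (simNew ts L)
  /-- Distribution transformation. -/
  | dist (x : Var) (v : Rhs) (C : BExp) (d t : Var) (w u : Rhs) (ht : t ∉ U)
      (hsplit : v.distSplit t = some (w, u)) :
      Rule U (.assign x v C d .nil) (distNew t x w u C d)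
  /-- Else transformation. -/
  | els (C : BExp) (b₁ b₂ : Block) (xs : List Var) (t : Var → Var) (hnd : xs.Nodup)
      (hxs : ∀ y, y ∈ xs ↔ y ∈ C.vars ∧ y ∈ b₁.assigned) (hinj : Set.InjOn t {y | y ∈ xs})
      (hfr : ∀ y ∈ xs, t y ∉ U) : Rule U (.ifElse C b₁ b₂ .nil) (elseNew xs t C b₁ b₂)
  /-- If transformation. -/
  | ite (C₁ : BExp) (x : Var) (v : Rhs) (C₂ : BExp) (rest : Block) (t : Var) (ht : t ∉ U) :
      Rule U (.ifThen C₁ (.assign x v C₂ x rest) .nil) (ifNew t C₁ x v C₂ rest)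
  /-- Multi-assignment transformation of at least two assignments to `x`. -/
  | multi (x : Var) (L : List (Var × Item)) (v : Rhs) (C : BExp) (d : Var) (hL : L ≠ [])
      (hnd : (L.map Prod.fst).Nodup) (hfr : ∀ y ∈ L.map Prod.fst, y ∉ U) :
      Rule U (multiOld x (L.map Prod.snd) v C d) (multiNew x x L v C d)

/-- `BlockStep U b b'`: `b'` results from `b` by applying one transformation to a contiguous part of
the statement list `b`, or of a branch at any depth in `b`. -/
inductive BlockStep (U : Finset Var) : Block → Block → Prop where
  | here {old new : Block} (post : Block) (h : Rule U old new) :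
      BlockStep U (old.append post) (new.append post)
  | assign (x : Var) (v : Rhs) (C : BExp) (d : Var) {r r' : Block} (h : BlockStep U r r') :
      BlockStep U (.assign x v C d r) (.assign x v C d r')
  | sim (L : List (Var × Rhs)) {r r' : Block} (h : BlockStep U r r') :
      BlockStep U (.sim L r) (.sim L r')
  | ifThenBranch (C : BExp) {b b' : Block} (r : Block) (h : BlockStep U b b') :
      BlockStep U (.ifThen C b r) (.ifThen C b' r)
  | ifThenTail (C : BExp) (b : Block) {r r' : Block} (h : BlockStep U r r') :
      BlockStep U (.ifThen C b r) (.ifThen C b r')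
  | ifElseLeft (C : BExp) {b b' : Block} (b₂ r : Block) (h : BlockStep U b b') :
      BlockStep U (.ifElse C b b₂ r) (.ifElse C b' b₂ r)
  | ifElseRight (C : BExp) (b₁ : Block) {b b' : Block} (r : Block) (h : BlockStep U b b') :
      BlockStep U (.ifElse C b₁ b r) (.ifElse C b₁ b' r)
  | ifElseTail (C : BExp) (b₁ b₂ : Block) {r r' : Block} (h : BlockStep U r r') :
      BlockStep U (.ifElse C b₁ b₂ r) (.ifElse C b₁ b₂ r')

/-- `P.Step Q`: the program `Q` results from `P` by applying one transformation to one subprogram of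
the initialization part or of the loop body; auxiliary variables do not occur in `P`. -/
inductive Program.Step (P : Program) : Program → Prop where
  | init {b : Block} (h : BlockStep P.allVars P.init b) : Program.Step P ⟨b, P.body⟩
  | body {b : Block} (h : BlockStep P.allVars P.body b) : Program.Step P ⟨P.init, b⟩

/-- A program is in normal form if none of the transformations is applicable to it. -/
def Program.NormalForm (P : Program) : Prop := ∀ Q, ¬ P.Step Q

/-! ### A procedure that applies the transformations

The functions in this part are executable. -/

/-- Search for the first assignment to `x` in a statement list (not in branches); returns the
statements before it, the assignment itself, and the statements after it. -/
def Block.findAssign (x : Var) : Block → Option (Block × Rhs × BExp × Var × Block)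
  | .nil => none
  | .assign y v C d r =>
      if y = x then some (.nil, v, C, d, r)
      else (r.findAssign x).map fun q => (.assign y v C d q.1, q.2)
  | .sim L r => (r.findAssign x).map fun q => (.sim L q.1, q.2)
  | .ifThen C b r => (r.findAssign x).map fun q => (.ifThen C b q.1, q.2)
  | .ifElse C b₁ b₂ r => (r.findAssign x).map fun q => (.ifElse C b₁ b₂ q.1, q.2)

/-- If a branch starts with an assignment `x = v [C₂] x`, the result of the if transformation. -/
def ifHead (t : Var) (C₁ : BExp) : Block → Option Block
  | .assign x v C₂ d rest => if d = x then some (ifNew t C₁ x v C₂ rest) else none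
  | _ => none

/-- Apply one transformation in a statement list, where `m` and all larger variables are unused. -/
def Block.next (m : Var) : Block → Option Block
  | .nil => none
  | .assign x v C d r =>
      match v.distSplit m with
      | some (w, u) => some ((distNew m x w u C d).append r)
      | none =>
        match r.findAssign x with
        | some (pre, v', C', d', post) =>
            some ((multiNew x x [(m, ⟨v, C, d, pre⟩)] v' C' d').append post)
        | none => (r.next m).map (.assign x v C d)
  | .sim L r => some ((simNew (List.range' m L.length) L).append r)
  | .ifThen C b r =>
      match ifHead m C b with
      | some b' => some (b'.append r)
      | none =>
        match b.next m with
        | some b' => some (.ifThen C b' r)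
        | none => (r.next m).map (.ifThen C b)
  | .ifElse C b₁ b₂ r =>
      some ((elseNew ((C.vars ∩ b₁.assigned).sort (· ≤ ·)) (fun y => m + y) C b₁ b₂).append r)

/-- Apply one transformation to a program, if one is applicable. -/
def Program.next (P : Program) : Option Program :=
  let m := P.allVars.sup id + 1
  match P.init.next m with
  | some b => some ⟨b, P.body⟩
  | none => (P.body.next m).map fun b => ⟨P.init, b⟩

/-! ### Semantics -/

noncomputable section

open scoped Classical

/-- Program states. Variables that do not occur in a program are carried along unchanged. -/
abbrev State := Var → ℝ

/-- Values of the symbolic constants. -/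
abbrev SymVal := Sym → ℝ

/-- Value of a constant. -/
def Const.eval (ρ : SymVal) : Const → ℝ
  | .num n => n
  | .real r => r
  | .sym a => ρ a
  | .add c₁ c₂ => c₁.eval ρ + c₂.eval ρ
  | .mul c₁ c₂ => c₁.eval ρ * c₂.eval ρ
  | .div c₁ c₂ => c₁.eval ρ / c₂.eval ρ

/-- Value of a polynomial expression. -/
def Poly.eval (ρ : SymVal) : Poly → State → ℝ
  | .const c, _ => c.eval ρ
  | .var x, s => s x
  | .add p q, s => p.eval ρ s + q.eval ρ s
  | .sub p q, s => p.eval ρ s - q.eval ρ s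
  | .mul p q, s => p.eval ρ s * q.eval ρ s
  | .pow p n, s => p.eval ρ s ^ n

/-- Truth of a condition. -/
def BExp.Holds (ρ : SymVal) : BExp → State → Prop
  | .tt, _ => True
  | .ff, _ => False
  | .eq p q, s => p.eval ρ s = q.eval ρ s
  | .ne p q, s => p.eval ρ s ≠ q.eval ρ s
  | .lt p q, s => p.eval ρ s < q.eval ρ s
  | .gt p q, s => q.eval ρ s < p.eval ρ s
  | .ge p q, s => q.eval ρ s ≤ p.eval ρ s
  | .le p q, s => p.eval ρ s ≤ q.eval ρ s
  | .not C, s => ¬ C.Holds ρ s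
  | .and C D, s => C.Holds ρ s ∧ D.Holds ρ s
  | .or C D, s => C.Holds ρ s ∨ D.Holds ρ s

theorem Poly.measurable_eval (ρ : SymVal) (p : Poly) : Measurable (p.eval ρ) := by
  induction p with
  | const c => exact measurable_const
  | var x => exact measurable_pi_apply x
  | add p q hp hq => exact hp.add hq
  | sub p q hp hq => exact hp.sub hq
  | mul p q hp hq => exact hp.mul hq
  | pow p n hp => exact hp.pow_const n

theorem BExp.measurableSet_holds (ρ : SymVal) (C : BExp) : MeasurableSet {s | C.Holds ρ s} := by
  induction C with
  | tt => exact MeasurableSet.univ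
  | ff => exact MeasurableSet.empty
  | eq p q => exact measurableSet_eq_fun (p.measurable_eval ρ) (q.measurable_eval ρ)
  | ne p q => exact (measurableSet_eq_fun (p.measurable_eval ρ) (q.measurable_eval ρ)).compl
  | lt p q => exact measurableSet_lt (p.measurable_eval ρ) (q.measurable_eval ρ)
  | gt p q => exact measurableSet_lt (q.measurable_eval ρ) (p.measurable_eval ρ)
  | ge p q => exact measurableSet_le (q.measurable_eval ρ) (p.measurable_eval ρ)
  | le p q => exact measurableSet_le (p.measurable_eval ρ) (q.measurable_eval ρ)
  | not C h => exact h.compl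
  | and C D hC hD => exact hC.inter hD
  | or C D hC hD => exact hC.union hD

/-! Distributions. -/

/-- The Bernoulli distribution on `{0, 1}`. -/
def bernoulliLaw (p : ℝ) : Measure ℝ :=
  ENNReal.ofReal p • Measure.dirac 1 + ENNReal.ofReal (1 - p) • Measure.dirac 0

/-- The uniform distribution on the interval `[a, b]`. -/
def uniformLaw (a b : ℝ) : Measure ℝ :=
  (ENNReal.ofReal (b - a))⁻¹ • (volume : Measure ℝ).restrict (Set.Icc a b)

/-- The Laplace distribution with location `m` and scale `b`, by its density. -/
def laplaceLaw (m b : ℝ) : Measure ℝ :=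
  (volume : Measure ℝ).withDensity fun x => ENNReal.ofReal (Real.exp (-(|x - m| / b)) / (2 * b))

/-- The last probability of a categorical expression; if omitted, what is missing to one. -/
def lastProb (ρ : SymVal) (L : List (Poly × Const)) : Option Const → ℝ
  | some c => c.eval ρ
  | none => 1 - (L.map fun c => c.2.eval ρ).sum

/-- The parameters of the right-hand side are admissible in the state `s`. -/
def Rhs.Valid (ρ : SymVal) : Rhs → State → Prop
  | .cat L _ o, _ => (∀ c ∈ L, 0 ≤ c.2.eval ρ) ∧ 0 ≤ lastProb ρ L o ∧
      (L.map fun c => c.2.eval ρ).sum + lastProb ρ L o = 1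
  | .bernoulli p, s => 0 ≤ p.eval ρ s ∧ p.eval ρ s ≤ 1
  | .normal _ v, s => 0 ≤ v.eval ρ s
  | .uniform a b, s => a.eval ρ s < b.eval ρ s
  | .laplace _ b, s => 0 < b.eval ρ s
  | .exponential r, s => 0 < r.eval ρ s
  | .expQuot c p, s => 0 < c.eval ρ ∧ 0 < p.eval ρ s
  | .other _ _ _, _ => True

/-- The law of the value of a right-hand side in the state `s`, for admissible parameters. -/
def Rhs.rawLaw (ρ : SymVal) : Rhs → State → Measure ℝ
  | .cat L p o, s =>
      (L.map fun c => ENNReal.ofReal (c.2.eval ρ) • Measure.dirac (c.1.eval ρ s)).sum +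
        ENNReal.ofReal (lastProb ρ L o) • Measure.dirac (p.eval ρ s)
  | .bernoulli p, s => bernoulliLaw (p.eval ρ s)
  | .normal m v, s => gaussianReal (m.eval ρ s) (v.eval ρ s).toNNReal
  | .uniform a b, s => uniformLaw (a.eval ρ s) (b.eval ρ s)
  | .laplace m b, s => laplaceLaw (m.eval ρ s) (b.eval ρ s)
  | .exponential r, s => expMeasure (r.eval ρ s)
  | .expQuot c p, s => expMeasure (c.eval ρ / p.eval ρ s)
  | .other _ D args, s => D.1 fun i => (args i).eval ρ s

/-- The law of the value of a right-hand side in the state `s`. With inadmissible parameters the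
value is `0` by convention; programs in which this happens are excluded by `Program.Admissible`. -/
def Rhs.law (ρ : SymVal) (v : Rhs) (s : State) : Measure ℝ :=
  if v.Valid ρ s then v.rawLaw ρ s else Measure.dirac 0

theorem Rhs.measurableSet_valid (ρ : SymVal) (v : Rhs) : MeasurableSet {s | v.Valid ρ s} := by
  cases v with
  | cat L p o => exact MeasurableSet.const _
  | bernoulli p =>
    exact (measurableSet_le measurable_const (p.measurable_eval ρ)).inter
      (measurableSet_le (p.measurable_eval ρ) measurable_const)
  | normal m v => exact measurableSet_le measurable_const (v.measurable_eval ρ)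
  | uniform a b => exact measurableSet_lt (a.measurable_eval ρ) (b.measurable_eval ρ)
  | laplace m b => exact measurableSet_lt measurable_const (b.measurable_eval ρ)
  | exponential r => exact measurableSet_lt measurable_const (r.measurable_eval ρ)
  | expQuot c p =>
    exact (MeasurableSet.const _).inter (measurableSet_lt measurable_const (p.measurable_eval ρ))
  | other k D args => exact MeasurableSet.univ

theorem measurable_withDensity {α : Type*} [MeasurableSpace α] {f : α → ℝ → ENNReal}
    (hf : Measurable (Function.uncurry f)) :
    Measurable fun a => (volume : Measure ℝ).withDensity (f a) := by
  have h := (Kernel.withDensity (Kernel.const α (volume : Measure ℝ)) f).measurable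
  have e : (fun a => (volume : Measure ℝ).withDensity (f a)) =
      fun a => Kernel.withDensity (Kernel.const α (volume : Measure ℝ)) f a := by
    funext a
    rw [Kernel.withDensity_apply _ hf, Kernel.const_apply]
  rw [e]
  exact h

theorem measurable_uniformLaw : Measurable fun q : ℝ × ℝ => uniformLaw q.1 q.2 := by
  refine Measure.measurable_of_measurable_coe _ fun E hE => ?_
  simp only [uniformLaw, Measure.smul_apply, smul_eq_mul, Measure.restrict_apply hE]
  refine Measurable.mul (by fun_prop) ?_
  have hm : MeasurableSet {z : (ℝ × ℝ) × ℝ | z.2 ∈ E ∧ z.1.1 ≤ z.2 ∧ z.2 ≤ z.1.2} :=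
    (measurable_snd hE).inter
      ((measurableSet_le (measurable_fst.comp measurable_fst) measurable_snd).inter
        (measurableSet_le measurable_snd (measurable_snd.comp measurable_fst)))
  exact measurable_measure_prodMk_left (ν := (volume : Measure ℝ)) hm

theorem measurable_laplaceLaw : Measurable fun q : ℝ × ℝ => laplaceLaw q.1 q.2 := by
  unfold laplaceLaw
  refine measurable_withDensity (f := fun (q : ℝ × ℝ) (x : ℝ) =>
    ENNReal.ofReal (Real.exp (-(|x - q.1| / q.2)) / (2 * q.2))) ?_
  have h1 : Measurable fun z : (ℝ × ℝ) × ℝ => |z.2 - z.1.1| := by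
    have : Measurable fun z : (ℝ × ℝ) × ℝ => z.2 - z.1.1 := by fun_prop
    exact this.norm
  have h2 : Measurable fun z : (ℝ × ℝ) × ℝ => z.1.2 := by fun_prop
  exact (((h1.div h2).neg.exp).div (measurable_const.mul h2)).ennreal_ofReal

theorem measurable_expMeasure : Measurable expMeasure := by
  unfold expMeasure gammaMeasure
  refine measurable_withDensity (f := fun r x => gammaPDF 1 r x) ?_
  unfold gammaPDF gammaPDFReal Function.uncurry
  refine Measurable.ennreal_ofReal (Measurable.ite ?_ ?_ measurable_const)
  · exact measurableSet_le measurable_const (by fun_prop)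
  · fun_prop

theorem isProbabilityMeasure_laplaceLaw (m : ℝ) {b : ℝ} (hb : 0 < b) :
    IsProbabilityMeasure (laplaceLaw m b) := by
  have hint0 : ∫ x : ℝ, Real.exp (-(|x| / b)) = 2 * b := by
    have h := integral_comp_abs (f := fun x : ℝ => Real.exp (-(x / b)))
    rw [h]
    have e : (fun x : ℝ => Real.exp (-(x / b))) = fun x => Real.exp ((-(1 / b)) * x) := by
      funext x
      ring_nf
    rw [e, integral_exp_mul_Ioi (by simpa using hb)]
    simp
  have hint1 : ∫ x : ℝ, Real.exp (-(|x - m| / b)) = 2 * b := by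
    rw [← hint0]
    exact integral_sub_right_eq_self (fun x : ℝ => Real.exp (-(|x| / b))) m
  have hI : Integrable fun x : ℝ => Real.exp (-(|x - m| / b)) := by
    by_contra h
    rw [integral_undef h] at hint1
    linarith
  constructor
  rw [laplaceLaw, withDensity_apply _ MeasurableSet.univ, Measure.restrict_univ,
    ← ofReal_integral_eq_lintegral_ofReal (hI.div_const _)
      (Filter.Eventually.of_forall fun x => by positivity),
    integral_div, hint1, div_self (by positivity)]
  simp

theorem isProbabilityMeasure_cat (ρ : SymVal) (L : List (Poly × Const)) (p : Poly)
    (o : Option Const) (s : State) (h : (Rhs.cat L p o).Valid ρ s) :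
    IsProbabilityMeasure ((Rhs.cat L p o).rawLaw ρ s) := by
  obtain ⟨h0, h1, h2⟩ := h
  constructor
  have key : ∀ K : List (Poly × Const), (∀ c ∈ K, 0 ≤ c.2.eval ρ) →
      (K.map fun c => ENNReal.ofReal (c.2.eval ρ) • Measure.dirac (c.1.eval ρ s)).sum Set.univ =
        ENNReal.ofReal (K.map fun c => c.2.eval ρ).sum ∧
      0 ≤ (K.map fun c => c.2.eval ρ).sum := by
    intro K
    induction K with
    | nil => simp
    | cons c K ih =>
      intro hK
      obtain ⟨i1, i2⟩ := ih fun c' hc' => hK c' (List.mem_cons_of_mem _ hc')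
      have hc := hK c List.mem_cons_self
      refine ⟨?_, ?_⟩
      · simp only [List.map_cons, List.sum_cons, Measure.add_apply, i1,
          Measure.smul_apply, measure_univ, smul_eq_mul, mul_one]
        rw [ENNReal.ofReal_add hc i2]
      · simp only [List.map_cons, List.sum_cons]
        exact add_nonneg hc i2
  obtain ⟨k1, k2⟩ := key L h0
  simp only [Rhs.rawLaw, Measure.add_apply, k1, Measure.smul_apply, measure_univ, smul_eq_mul,
    mul_one]
  rw [← ENNReal.ofReal_add k2 h1, h2, ENNReal.ofReal_one]

theorem measurable_comp₂ {F : ℝ → ℝ → Measure ℝ} (hF : Measurable fun q : ℝ × ℝ => F q.1 q.2)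
    {f g : State → ℝ} (hf : Measurable f) (hg : Measurable g) :
    Measurable fun s => F (f s) (g s) :=
  hF.comp (hf.prodMk hg)

theorem Rhs.measurable_rawLaw (ρ : SymVal) (v : Rhs) : Measurable (v.rawLaw ρ) := by
  cases v with
  | cat L p o =>
    have dm : ∀ (a : ENNReal) (q : Poly),
        Measurable fun s : State => a • Measure.dirac (q.eval ρ s) := by
      intro a q
      refine Measure.measurable_of_measurable_coe _ fun E hE => ?_
      simp only [Measure.smul_apply, smul_eq_mul]
      exact ((Measure.measurable_coe hE).comp
        (Measure.measurable_dirac.comp (q.measurable_eval ρ))).const_mul a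
    have am : ∀ μ ν : State → Measure ℝ, Measurable μ → Measurable ν →
        Measurable fun s => μ s + ν s := by
      intro μ ν hμ hν
      refine Measure.measurable_of_measurable_coe _ fun E hE => ?_
      simp only [Measure.add_apply]
      exact ((Measure.measurable_coe hE).comp hμ).add ((Measure.measurable_coe hE).comp hν)
    have hL : ∀ K : List (Poly × Const), Measurable fun s : State =>
        (K.map fun c => ENNReal.ofReal (c.2.eval ρ) • Measure.dirac (c.1.eval ρ s)).sum := by
      intro K
      induction K with
      | nil => exact measurable_const
      | cons c K ih =>
        simp only [List.map_cons, List.sum_cons]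
        exact am _ _ (dm _ c.1) ih
    exact am _ _ (hL L) (dm _ p)
  | bernoulli p =>
    have hp := p.measurable_eval ρ
    refine Measure.measurable_of_measurable_coe _ fun E hE => ?_
    simp only [Rhs.rawLaw, bernoulliLaw, Measure.add_apply, Measure.smul_apply, smul_eq_mul]
    fun_prop
  | normal m v =>
    have h := (m.measurable_eval ρ).prodMk (v.measurable_eval ρ).real_toNNReal
    exact (measurable_gaussianReal.comp h :
      Measurable fun s => Function.uncurry gaussianReal (m.eval ρ s, (v.eval ρ s).toNNReal))
  | uniform a b =>
    have h := measurable_comp₂ measurable_uniformLaw (a.measurable_eval ρ) (b.measurable_eval ρ)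
    exact h
  | laplace m b =>
    have h := measurable_comp₂ measurable_laplaceLaw (m.measurable_eval ρ) (b.measurable_eval ρ)
    exact h
  | exponential r => exact measurable_expMeasure.comp (r.measurable_eval ρ)
  | expQuot c p =>
    exact measurable_expMeasure.comp (measurable_const.div (p.measurable_eval ρ))
  | other k D args =>
    exact D.1.measurable.comp (measurable_pi_lambda _ fun i => (args i).measurable_eval ρ)

theorem Rhs.isProbabilityMeasure_rawLaw (ρ : SymVal) (v : Rhs) (s : State) (h : v.Valid ρ s) :
    IsProbabilityMeasure (v.rawLaw ρ s) := by
  cases v with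
  | cat L p o => exact isProbabilityMeasure_cat ρ L p o s h
  | bernoulli p =>
    constructor
    simp only [Rhs.rawLaw, bernoulliLaw, Measure.add_apply, Measure.smul_apply, measure_univ,
      smul_eq_mul, mul_one]
    rw [← ENNReal.ofReal_add h.1 (by linarith [h.2])]
    simp
  | normal m v => exact (inferInstance : IsProbabilityMeasure (gaussianReal _ _))
  | uniform a b =>
    have hpos : 0 < b.eval ρ s - a.eval ρ s := sub_pos.2 h
    constructor
    simp only [Rhs.rawLaw, uniformLaw, Measure.smul_apply, Measure.restrict_apply_univ,
      Real.volume_Icc, smul_eq_mul]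
    exact ENNReal.inv_mul_cancel (by simpa using hpos) ENNReal.ofReal_ne_top
  | laplace m b => exact isProbabilityMeasure_laplaceLaw _ h
  | exponential r => exact isProbabilityMeasure_expMeasure h
  | expQuot c p => exact isProbabilityMeasure_expMeasure (div_pos h.1 h.2)
  | other k D args =>
    have := D.2
    exact (inferInstance : IsProbabilityMeasure (D.1 _))

/-- The law of the value of a right-hand side as a kernel from states to the reals. -/
def Rhs.kernel (ρ : SymVal) (v : Rhs) : Kernel State ℝ where
  toFun := v.law ρ
  measurable' :=
    Measurable.ite (v.measurableSet_valid ρ) (v.measurable_rawLaw ρ) measurable_const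

instance (ρ : SymVal) (v : Rhs) : IsMarkovKernel (v.kernel ρ) := by
  refine ⟨fun s => ?_⟩
  change IsProbabilityMeasure (v.law ρ s)
  unfold Rhs.law
  split_ifs with h
  · exact v.isProbabilityMeasure_rawLaw ρ s h
  · infer_instance

/-! Statements. -/

/-- One draw of a simultaneous assignment: the first component is the state in which all right-hand
sides are evaluated, the second component is the state that is updated. -/
def drawKernel (ρ : SymVal) (x : Var) (v : Rhs) : Kernel (State × State) (State × State) :=
  ((Kernel.id : Kernel (State × State) (State × State)) ×ₖ
    (v.kernel ρ).comap Prod.fst measurable_fst).map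
      fun q => (q.1.1, Function.update q.1.2 x q.2)

theorem measurable_drawUpdate (x : Var) :
    Measurable fun q : (State × State) × ℝ => (q.1.1, Function.update q.1.2 x q.2) := by
  refine Measurable.prodMk (by fun_prop) (measurable_pi_lambda _ fun y => ?_)
  by_cases h : y = x
  · subst h
    simpa using measurable_snd
  · simp only [Function.update_of_ne h]
    exact (measurable_pi_apply y).comp (measurable_snd.comp measurable_fst)

instance (ρ : SymVal) (x : Var) (v : Rhs) : IsMarkovKernel (drawKernel ρ x v) :=
  Kernel.IsMarkovKernel.map _ (measurable_drawUpdate x)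

/-- The draws of a simultaneous assignment, all of them with the right-hand sides evaluated in the
state in the first component, and independent of each other. -/
def drawsKernel (ρ : SymVal) : List (Var × Rhs) → Kernel (State × State) (State × State)
  | [] => Kernel.id
  | (x, v) :: L => drawsKernel ρ L ∘ₖ drawKernel ρ x v

instance (ρ : SymVal) (L : List (Var × Rhs)) : IsMarkovKernel (drawsKernel ρ L) := by
  induction L with
  | nil => exact (inferInstance : IsMarkovKernel (Kernel.id : Kernel (State × State) _))
  | cons c L ih =>
    obtain ⟨x, v⟩ := c
    exact (inferInstance : IsMarkovKernel (drawsKernel ρ L ∘ₖ drawKernel ρ x v))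

/-- Execution of the simultaneous assignment `x₁, …, xₗ = v₁, …, vₗ`. -/
def simKernel (ρ : SymVal) (L : List (Var × Rhs)) : Kernel State State :=
  ((drawsKernel ρ L).comap (fun s : State => (s, s))
    (measurable_id.prodMk measurable_id)).map Prod.snd

instance (ρ : SymVal) (L : List (Var × Rhs)) : IsMarkovKernel (simKernel ρ L) :=
  Kernel.IsMarkovKernel.map _ measurable_snd

theorem measurable_copy (x d : Var) :
    Measurable fun s : State => Function.update s x (s d) := by
  refine measurable_pi_lambda _ fun y => ?_
  by_cases h : y = x
  · subst h
    simpa using measurable_pi_apply d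
  · simp only [Function.update_of_ne h]
    exact measurable_pi_apply y

theorem measurable_store (x : Var) :
    Measurable fun q : State × ℝ => Function.update q.1 x q.2 := by
  refine measurable_pi_lambda _ fun y => ?_
  by_cases h : y = x
  · subst h
    simpa using measurable_snd
  · simp only [Function.update_of_ne h]
    exact (measurable_pi_apply y).comp measurable_fst

/-- Execution of the plain assignment `x = v`. -/
def storeKernel (ρ : SymVal) (x : Var) (v : Rhs) : Kernel State State :=
  ((Kernel.id : Kernel State State) ×ₖ v.kernel ρ).map fun q => Function.update q.1 x q.2

instance (ρ : SymVal) (x : Var) (v : Rhs) : IsMarkovKernel (storeKernel ρ x v) :=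
  Kernel.IsMarkovKernel.map _ (measurable_store x)

/-- Execution of the conditioned assignment `x = v [C] d`: if `C` holds then `x` gets the value of
`v`, else `x` gets the value of `d`. -/
def assignKernel (ρ : SymVal) (x : Var) (v : Rhs) (C : BExp) (d : Var) : Kernel State State :=
  Kernel.piecewise (C.measurableSet_holds ρ)
    (storeKernel ρ x v)
    (Kernel.deterministic (fun s : State => Function.update s x (s d)) (measurable_copy x d))

instance (ρ : SymVal) (x : Var) (v : Rhs) (C : BExp) (d : Var) :
    IsMarkovKernel (assignKernel ρ x v C d) := by
  unfold assignKernel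
  infer_instance

/-- Execution of a statement list. -/
def Block.kernel (ρ : SymVal) : Block → Kernel State State
  | .nil => Kernel.id
  | .assign x v C d r => r.kernel ρ ∘ₖ assignKernel ρ x v C d
  | .sim L r => r.kernel ρ ∘ₖ simKernel ρ L
  | .ifThen C b r =>
      r.kernel ρ ∘ₖ Kernel.piecewise (C.measurableSet_holds ρ) (b.kernel ρ) Kernel.id
  | .ifElse C b₁ b₂ r =>
      r.kernel ρ ∘ₖ Kernel.piecewise (C.measurableSet_holds ρ) (b₁.kernel ρ) (b₂.kernel ρ)

instance (ρ : SymVal) (b : Block) : IsMarkovKernel (b.kernel ρ) := by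
  induction b with
  | nil => exact (inferInstance : IsMarkovKernel (Kernel.id : Kernel State State))
  | assign x v C d r ih =>
    exact (inferInstance : IsMarkovKernel (r.kernel ρ ∘ₖ assignKernel ρ x v C d))
  | sim L r ih => exact (inferInstance : IsMarkovKernel (r.kernel ρ ∘ₖ simKernel ρ L))
  | ifThen C b r ihb ihr =>
    exact (inferInstance : IsMarkovKernel (r.kernel ρ ∘ₖ
      Kernel.piecewise (C.measurableSet_holds ρ) (b.kernel ρ) Kernel.id))
  | ifElse C b₁ b₂ r ih₁ ih₂ ihr =>
    exact (inferInstance : IsMarkovKernel (r.kernel ρ ∘ₖ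
      Kernel.piecewise (C.measurableSet_holds ρ) (b₁.kernel ρ) (b₂.kernel ρ)))

/-- Almost surely, every right-hand side that is evaluated during the execution of the statement
list from the state `s` has admissible parameters. -/
def Block.Safe (ρ : SymVal) : Block → State → Prop
  | .nil, _ => True
  | .assign x v C d r, s =>
      (C.Holds ρ s → v.Valid ρ s) ∧ ∀ᵐ s' ∂(assignKernel ρ x v C d s), r.Safe ρ s'
  | .sim L r, s =>
      (∀ c ∈ L, c.2.Valid ρ s) ∧ ∀ᵐ s' ∂(simKernel ρ L s), r.Safe ρ s'
  | .ifThen C b r, s =>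
      (C.Holds ρ s → b.Safe ρ s) ∧
        ∀ᵐ s' ∂(Kernel.piecewise (C.measurableSet_holds ρ) (b.kernel ρ) Kernel.id s), r.Safe ρ s'
  | .ifElse C b₁ b₂ r, s =>
      (C.Holds ρ s → b₁.Safe ρ s) ∧ (¬ C.Holds ρ s → b₂.Safe ρ s) ∧
        ∀ᵐ s' ∂(Kernel.piecewise (C.measurableSet_holds ρ) (b₁.kernel ρ) (b₂.kernel ρ) s),
          r.Safe ρ s'

/-! Programs. -/

/-- The run measure of a program, on sequences of states: the law of the Markov chain whose initial
distribution is the law of the state after the initialization part, and whose transition kernel is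
the execution of the loop body. The state `σ` before the initialization part holds the values of the
uninitialized variables. -/
def Program.runMeasure (P : Program) (ρ : SymVal) (σ : State) : Measure (ℕ → State) :=
  Kernel.trajMeasure (X := fun _ => State) (P.init.kernel ρ σ) fun n =>
    (P.body.kernel ρ).comap
      (fun h : (i : Finset.Iic n) → State => h ⟨n, Finset.mem_Iic.2 le_rfl⟩)
      (measurable_pi_apply _)

/-- Almost surely, no draw with inadmissible parameters is executed, neither in the initialization
part nor in any iteration of the loop body. -/
def Program.Admissible (P : Program) (ρ : SymVal) (σ : State) : Prop :=
  P.init.Safe ρ σ ∧ ∀ᵐ ω ∂(P.runMeasure ρ σ), ∀ n, P.body.Safe ρ (ω n)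

/-- The joint distribution of the variables in `X`: the joint law of the values of all `x ∈ X` after
`n` iterations, for all `n` together. -/
def Program.jointLaw (P : Program) (ρ : SymVal) (σ : State) (X : Finset Var) :
    Measure (ℕ → X → ℝ) :=
  (P.runMeasure ρ σ).map fun ω n x => ω n x

/-- Equivalence with respect to the variables in `X`, for all values of the symbolic constants and
of the uninitialized variables for which `P` is admissible; then `Q` has to be admissible too. -/
def Program.EquivOn (X : Finset Var) (P Q : Program) : Prop :=
  X ⊆ P.Vars ∩ Q.Vars ∧ ∀ (ρ : SymVal) (σ : State), P.Admissible ρ σ →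
    Q.Admissible ρ σ ∧ P.jointLaw ρ σ X = Q.jointLaw ρ σ X

end

end ProbLoop

/-!
Termination. Give each assignment in a statement list the weight `3 ^ depth`, three times that if
its right-hand side is a draw that can still be split, and give simultaneous assignments and
if-else-statements enough weight to pay for the assignments that replace them (`Block.weight`).
All transformations except for the multi-assignment transformation decrease this weight: a draw is
split only once, and the if transformation turns one assignment in a branch into at most two
assignments one level further out. The multi-assignment transformation does not increase the
weight and keeps the number of assignments, but it assigns a variable that was not assigned
before. So the weight together with the number of assignments in excess of the number of assigned
variables decreases lexicographically (`Program.Step.measure_lt`), and the procedure reaches a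
normal form, because it finds a transformation if there is one (`Program.next_eq_none_iff`).

Equivalence. Let `U` be the set of variables that occur in the program before a transformation.
The relation `Block.Refines` says that a statement list, whenever it is safe, and its transform
produce the same law of the values of the variables in `U`, from any two states that agree on `U`;
more generally, a variable may be stored under different names before and after the execution,
which is what the multi-assignment transformation does. Refinement is closed under concatenation
(`Block.Refines.append`) and branching and invariant under injective renaming
(`Block.refines_rename`), so it is enough to check it for the five rules (`Rule.refines`). The
distribution transformation is the fact that normal, uniform, Laplace and exponential
distributions are location-scale families, and only for admissible parameters do the laws agree,
which is why safety is assumed. The else and if transformations rest on the fact that an execution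
almost surely leaves unassigned variables unchanged (`Block.ae_unchanged`), so that the test of
the renamed condition repeats the test of the original one.

Auxiliary variables keep their values from one iteration of the loop to the next, but the values
of the variables in `U` after the loop body depend only on the values of the variables in `U`
before it. By induction on `n`, the histories up to time `n` have the same law on `U`
(`Program.map_histView_eq`), and these determine the joint law of the run.
-/

namespace ProbLoop

/-! ### Concatenation, occurring variables, and renaming -/

theorem Block.append_nil (b : Block) : b.append .nil = b := by
  induction b <;> simp_all [Block.append]

theorem Block.append_assoc (a b c : Block) : (a.append b).append c = a.append (b.append c) := by
  induction a <;> simp_all [Block.append]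

theorem Block.assigned_sim (L : List (Var × Rhs)) (r : Block) :
    (Block.sim L r).assigned = (L.map Prod.fst).toFinset ∪ r.assigned := by
  induction L with
  | nil => simp [Block.assigned]
  | cons c L ih => simp_all [Block.assigned]

theorem Block.mem_vars_sim (L : List (Var × Rhs)) (r : Block) (z : Var) :
    z ∈ (Block.sim L r).vars ↔ (∃ c ∈ L, z = c.1 ∨ z ∈ c.2.vars) ∨ z ∈ r.vars := by
  induction L with
  | nil => simp [Block.vars]
  | cons c L ih =>
    simp only [Block.vars, List.foldr_cons, Finset.mem_insert, Finset.mem_union,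
      List.exists_mem_cons_iff] at ih ⊢
    simp only [ih, or_assoc]

theorem Block.assigned_append (a b : Block) :
    (a.append b).assigned = a.assigned ∪ b.assigned := by
  induction a with
  | nil => simp [Block.append, Block.assigned]
  | sim L r ih => rw [Block.append, Block.assigned_sim, Block.assigned_sim, ih, Finset.union_assoc]
  | assign | ifThen | ifElse => simp_all [Block.append, Block.assigned, Finset.union_assoc]

theorem Block.vars_append (a b : Block) : (a.append b).vars = a.vars ∪ b.vars := by
  induction a with
  | nil => simp [Block.append, Block.vars]
  | sim L r ih =>
    ext z
    simp only [Block.append, Block.mem_vars_sim, ih, Finset.mem_union, or_assoc]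
  | assign | ifThen | ifElse => simp_all [Block.append, Block.vars, Finset.union_assoc]

theorem Block.assigned_subset_vars (b : Block) : b.assigned ⊆ b.vars := by
  induction b with
  | nil => simp [Block.assigned]
  | assign x v C d r ih =>
    intro z hz
    simp only [Block.assigned, Block.vars, Finset.mem_insert, Finset.mem_union,
      Finset.mem_singleton] at hz ⊢
    rcases hz with hz | hz
    · simp [hz]
    · simp [ih hz]
  | sim L r ih =>
    intro z hz
    simp only [Block.assigned_sim, Block.mem_vars_sim, Finset.mem_union, List.mem_toFinset,
      List.mem_map] at hz ⊢
    rcases hz with ⟨c, hc, rfl⟩ | hz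
    · exact Or.inl ⟨c, hc, Or.inl rfl⟩
    · exact Or.inr (ih hz)
  | ifThen C b r ihb ihr =>
    intro z hz
    simp only [Block.assigned, Block.vars, Finset.mem_union] at hz ⊢
    rcases hz with hz | hz
    · simp [ihb hz]
    · simp [ihr hz]
  | ifElse C b₁ b₂ r ih₁ ih₂ ihr =>
    intro z hz
    simp only [Block.assigned, Block.vars, Finset.mem_union] at hz ⊢
    rcases hz with (hz | hz) | hz
    · simp [ih₁ hz]
    · simp [ih₂ hz]
    · simp [ihr hz]

theorem Block.assigned_assigns (L : List (Var × Rhs)) :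
    (Block.assigns L).assigned = (L.map Prod.fst).toFinset := by
  induction L with
  | nil => simp [Block.assigns, Block.assigned]
  | cons c L ih => simp [Block.assigns, Block.assigned, ih]

theorem Poly.vars_rename (f : Var → Var) (p : Poly) : (p.rename f).vars = p.vars.image f := by
  induction p <;> simp_all [Poly.rename, Poly.vars, Finset.image_union]

theorem BExp.vars_rename (f : Var → Var) (C : BExp) : (C.rename f).vars = C.vars.image f := by
  induction C <;> simp_all [BExp.rename, BExp.vars, Poly.vars_rename, Finset.image_union]

theorem Block.assigned_rename (f : Var → Var) (b : Block) :
    (b.rename f).assigned = b.assigned.image f := by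
  induction b with
  | sim L r ih =>
    rw [Block.rename, Block.assigned_sim, Block.assigned_sim, ih, Finset.image_union]
    congr 1
    ext z
    simp
  | nil | assign | ifThen | ifElse =>
    simp_all [Block.rename, Block.assigned, Finset.image_union, Finset.image_insert]

theorem Poly.isZero_rename (f : Var → Var) (p : Poly) : (p.rename f).isZero = p.isZero := by
  cases p <;> rfl

theorem Poly.isOne_rename (f : Var → Var) (p : Poly) : (p.rename f).isOne = p.isOne := by
  cases p <;> rfl

theorem Rhs.isSome_distSplit_rename (f : Var → Var) (v : Rhs) (t t' : Var) :
    ((v.rename f).distSplit t).isSome = (v.distSplit t').isSome := by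
  cases v <;> simp only [Rhs.rename, Rhs.distSplit, Poly.isZero_rename, Poly.isOne_rename] <;>
    (try split_ifs) <;> rfl

/-- Whether a draw can be split does not depend on the auxiliary variable. -/
theorem Rhs.isSome_distSplit (v : Rhs) (t t' : Var) :
    (v.distSplit t).isSome = (v.distSplit t').isSome := by
  cases v <;> simp only [Rhs.distSplit] <;> (try split_ifs) <;> rfl

/-- A draw that has been split cannot be split again. -/
theorem Rhs.distSplit_eq_none {v w u : Rhs} {t : Var} (h : v.distSplit t = some (w, u)) :
    w.distSplit t = none ∧ u.distSplit t = none := by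
  cases v <;> simp only [Rhs.distSplit] at h <;> (try split_ifs at h) <;>
    first
    | (simp only [Option.some.injEq, Prod.mk.injEq] at h
       obtain ⟨rfl, rfl⟩ := h
       exact ⟨rfl, rfl⟩)
    | simp at h

/-! ### Termination -/

/-- The weight of a right-hand side: a splittable draw counts more than the two assignments that
replace it. -/
def Rhs.weight (v : Rhs) : ℕ := if (v.distSplit 0).isSome then 3 else 1

/-- The weight of a statement list. Each level of nesting multiplies it by three, because the if
transformation turns one assignment in a branch into at most two assignments outside of it. The
multi-assignment transformation does not increase the weight, the other four decrease it. -/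
def Block.weight : Block → ℕ
  | .nil => 0
  | .assign _ v _ _ r => v.weight + r.weight
  | .sim L r => 4 * L.length + 1 + r.weight
  | .ifThen _ b r => 3 * b.weight + r.weight
  | .ifElse C b₁ b₂ r => C.vars.card + 1 + 3 * b₁.weight + 3 * b₂.weight + r.weight

/-- The number of assignments in a statement list. -/
def Block.count : Block → ℕ
  | .nil => 0
  | .assign _ _ _ _ r => 1 + r.count
  | .sim L r => L.length + r.count
  | .ifThen _ b r => b.count + r.count
  | .ifElse _ b₁ b₂ r => b₁.count + b₂.count + r.count

theorem Rhs.weight_rename (f : Var → Var) (v : Rhs) : (v.rename f).weight = v.weight := by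
  rw [Rhs.weight, Rhs.weight, v.isSome_distSplit_rename f 0 0]

theorem Rhs.one_le_weight (v : Rhs) : 1 ≤ v.weight := by
  unfold Rhs.weight; split_ifs <;> omega

theorem Rhs.weight_le (v : Rhs) : v.weight ≤ 3 := by
  unfold Rhs.weight; split_ifs <;> omega

theorem Rhs.weight_ofPoly (p : Poly) : (Rhs.ofPoly p).weight = 1 := rfl

theorem Block.weight_append (a b : Block) : (a.append b).weight = a.weight + b.weight := by
  induction a <;> simp_all [Block.append, Block.weight, Nat.add_assoc]

theorem Block.count_append (a b : Block) : (a.append b).count = a.count + b.count := by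
  induction a <;> simp_all [Block.append, Block.count, Nat.add_assoc]

theorem Block.weight_rename_le (f : Var → Var) (b : Block) : (b.rename f).weight ≤ b.weight := by
  induction b with
  | nil => simp [Block.rename]
  | assign x v C d r ih => simp [Block.rename, Block.weight, Rhs.weight_rename, ih]
  | sim L r ih => simp [Block.rename, Block.weight, ih]
  | ifThen C b r ihb ihr => simp only [Block.rename, Block.weight]; omega
  | ifElse C b₁ b₂ r ih₁ ih₂ ihr =>
    have h : (C.rename f).vars.card ≤ C.vars.card := by
      rw [BExp.vars_rename]
      exact Finset.card_image_le
    simp only [Block.rename, Block.weight]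
    omega

theorem Block.count_rename (f : Var → Var) (b : Block) : (b.rename f).count = b.count := by
  induction b <;> simp_all [Block.rename, Block.count]

theorem Block.card_assigned_le_count (b : Block) : b.assigned.card ≤ b.count := by
  induction b with
  | nil => simp [Block.assigned]
  | assign x v C d r ih =>
    have := Finset.card_insert_le x r.assigned
    simp only [Block.assigned, Block.count]; omega
  | sim L r ih =>
    have h1 := Finset.card_union_le (L.map Prod.fst).toFinset r.assigned
    have h2 := (L.map Prod.fst).toFinset_card_le
    rw [List.length_map] at h2
    rw [Block.assigned_sim, Block.count]; omega
  | ifThen C b r ihb ihr =>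
    have := Finset.card_union_le b.assigned r.assigned
    simp only [Block.assigned, Block.count]; omega
  | ifElse C b₁ b₂ r ih₁ ih₂ ihr =>
    have h1 := Finset.card_union_le (b₁.assigned ∪ b₂.assigned) r.assigned
    have h2 := Finset.card_union_le b₁.assigned b₂.assigned
    simp only [Block.assigned, Block.count]; omega

theorem Block.weight_assigns_le (L : List (Var × Rhs)) :
    (Block.assigns L).weight ≤ 3 * L.length := by
  induction L with
  | nil => simp [Block.assigns, Block.weight]
  | cons c L ih =>
    have := c.2.weight_le
    simp only [Block.assigns, Block.weight, List.length_cons]; omega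

theorem Block.weight_assigns_of_ofPoly {L : List (Var × Rhs)}
    (h : ∀ c ∈ L, ∃ p, c.2 = Rhs.ofPoly p) : (Block.assigns L).weight = L.length := by
  induction L with
  | nil => rfl
  | cons c L ih =>
    obtain ⟨p, hp⟩ := h c List.mem_cons_self
    have ih' := ih fun c hc => h c (List.mem_cons_of_mem _ hc)
    simp only [Block.assigns, Block.weight, hp, Rhs.weight_ofPoly, ih', List.length_cons]; omega

/-- The auxiliary variables need not be fresh here, so the renaming may merge variables of the
condition of an if-else-statement; hence only an inequality. -/
theorem weight_multiNew_le (x : Var) (L : List (Var × Item)) (v : Rhs) (C : BExp) (d prev : Var) :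
    (multiNew x prev L v C d).weight ≤ (multiOld x (L.map Prod.snd) v C d).weight := by
  induction L generalizing prev with
  | nil => simp [multiNew, multiOld, Block.weight, Rhs.weight_rename]
  | cons i L ih =>
    have h1 := ih i.1
    have h2 := i.2.rest.weight_rename_le (sub x i.1)
    simp only [multiNew, multiOld, List.map_cons, Block.weight, Block.weight_append,
      Rhs.weight_rename]
    omega

theorem count_multiNew (x : Var) (L : List (Var × Item)) (v : Rhs) (C : BExp) (d prev : Var) :
    (multiNew x prev L v C d).count = (multiOld x (L.map Prod.snd) v C d).count := by
  induction L generalizing prev with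
  | nil => simp [multiNew, multiOld, Block.count]
  | cons i L ih =>
    simp [multiNew, multiOld, Block.count, Block.count_append, Block.count_rename, ih i.1]

theorem mem_assigned_multiNew (x : Var) (L : List (Var × Item)) (v : Rhs) (C : BExp)
    (d prev : Var) : x ∈ (multiNew x prev L v C d).assigned := by
  induction L generalizing prev with
  | nil => simp [multiNew, Block.assigned]
  | cons i L ih => simp [multiNew, Block.assigned, Block.assigned_append, ih i.1]

theorem assigned_multiOld_subset (x : Var) (L : List (Var × Item)) (v : Rhs) (C : BExp)
    (d prev : Var) :
    (multiOld x (L.map Prod.snd) v C d).assigned ⊆ (multiNew x prev L v C d).assigned := by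
  induction L generalizing prev with
  | nil => simp [multiNew, multiOld, Block.assigned]
  | cons i L ih =>
    intro z hz
    by_cases hzx : z = x
    · rw [hzx]
      exact mem_assigned_multiNew x _ v C d prev
    · simp only [multiOld, List.map_cons, Block.assigned, Block.assigned_append,
        Finset.mem_insert, Finset.mem_union, hzx, false_or] at hz
      simp only [multiNew, Block.assigned, Block.assigned_append, Block.assigned_rename,
        Finset.mem_insert, Finset.mem_union, Finset.mem_image]
      rcases hz with hz | hz
      · exact Or.inr (Or.inl ⟨z, hz, by simp [sub, hzx]⟩)
      · exact Or.inr (Or.inr (ih i.1 hz))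

theorem Block.assigned_simNew (ts : List Var) (L : List (Var × Rhs)) (h : ts.length = L.length) :
    (Block.sim L .nil).assigned ⊆ (simNew ts L).assigned := by
  rw [Block.assigned_sim, simNew, Block.assigned_append, Block.assigned_assigns,
    Block.assigned_assigns, List.map_fst_zip (l₁ := L.map Prod.fst) (by simp [h])]
  simp [Block.assigned]

/-- What one transformation does to the termination measure: either the weight decreases, or the
weight does not increase, the number of assignments remains, and one more variable is assigned. -/
structure Progress (U : Finset Var) (b b' : Block) : Prop where
  assigned_subset : b.assigned ⊆ b'.assigned
  decrease : b'.weight < b.weight ∨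
    (b'.weight ≤ b.weight ∧ b'.count = b.count ∧ ∃ y ∈ b'.assigned, y ∉ U)

theorem Rule.progress {U : Finset Var} {b b' : Block} (h : Rule U b b') : Progress U b b' := by
  cases h with
  | sim L ts hlen hnd hfr =>
    refine ⟨Block.assigned_simNew ts L hlen, Or.inl ?_⟩
    have h1 := Block.weight_assigns_le (ts.zip (L.map Prod.snd))
    have h2 : (Block.assigns ((L.map Prod.fst).zip (ts.map fun t => Rhs.ofPoly (.var t)))).weight =
        ((L.map Prod.fst).zip (ts.map fun t => Rhs.ofPoly (.var t))).length := by
      refine Block.weight_assigns_of_ofPoly fun c hc => ?_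
      have := (List.of_mem_zip (a := c.1) (b := c.2) hc).2
      simp only [List.mem_map] at this
      obtain ⟨t, -, ht⟩ := this
      exact ⟨_, ht.symm⟩
    simp only [List.length_zip, List.length_map, hlen, min_self] at h1 h2
    rw [simNew, Block.weight_append, h2, Block.weight, Block.weight]
    omega
  | dist x v C d t w u ht hsplit =>
    refine ⟨by simp [distNew, Block.assigned], Or.inl ?_⟩
    obtain ⟨hw, hu⟩ := Rhs.distSplit_eq_none hsplit
    have e1 : w.weight = 1 := by simp [Rhs.weight, w.isSome_distSplit 0 t, hw]
    have e2 : u.weight = 1 := by simp [Rhs.weight, u.isSome_distSplit 0 t, hu]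
    have e3 : v.weight = 3 := by simp [Rhs.weight, v.isSome_distSplit 0 t, hsplit]
    simp [distNew, Block.weight, e1, e2, e3]
  | els C b₁ b₂ xs t hnd hxs hinj hfr =>
    -- There are at most as many auxiliary variables as variables in the condition.
    refine ⟨?_, Or.inl ?_⟩
    · intro z hz
      simp only [Block.assigned, Finset.mem_union, Finset.notMem_empty, or_false] at hz
      simp only [elseNew, Block.assigned_append, Block.assigned, Finset.mem_union]
      tauto
    · have h1 : xs.length ≤ C.vars.card := by
        rw [← List.toFinset_card_of_nodup hnd]
        exact Finset.card_le_card fun y hy => ((hxs y).1 (List.mem_toFinset.1 hy)).1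
      have h2 : (Block.assigns (xs.map fun y => (t y, Rhs.ofPoly (.var y)))).weight =
          (xs.map fun y => (t y, Rhs.ofPoly (.var y))).length := by
        refine Block.weight_assigns_of_ofPoly fun c hc => ?_
        simp only [List.mem_map] at hc
        obtain ⟨y, -, rfl⟩ := hc
        exact ⟨_, rfl⟩
      rw [List.length_map] at h2
      simp only [elseNew, Block.weight_append, Block.weight, h2]
      omega
  | ite C₁ x v C₂ rest t ht =>
    have h1 := v.one_le_weight
    refine ⟨?_, Or.inl ?_⟩
    · intro z hz
      simp only [Block.assigned, Finset.mem_union, Finset.notMem_empty, or_false] at hz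
      unfold ifNew
      cases rest <;> split_ifs <;> simp_all [Block.assigned]
    · unfold ifNew
      cases rest <;> split_ifs <;> simp only [Block.weight, Rhs.weight_ofPoly] <;> omega
  | multi x L v C d hL hnd hfr =>
    refine ⟨assigned_multiOld_subset x L v C d x, Or.inr ⟨weight_multiNew_le x L v C d x,
      count_multiNew x L v C d x, ?_⟩⟩
    cases L with
    | nil => exact absurd rfl hL
    | cons i L => exact ⟨i.1, by simp [multiNew, Block.assigned], hfr _ (by simp)⟩

theorem BlockStep.progress {U : Finset Var} {b b' : Block} (h : BlockStep U b b') :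
    Progress U b b' := by
  induction h with
  | here post h =>
    obtain ⟨h1, h2⟩ := h.progress
    refine ⟨?_, ?_⟩
    · simp only [Block.assigned_append]
      exact Finset.union_subset_union h1 subset_rfl
    · simp only [Block.weight_append, Block.count_append, Block.assigned_append, Finset.mem_union]
      rcases h2 with h2 | ⟨h2, h3, y, hy, hyU⟩
      · left; omega
      · exact Or.inr ⟨by omega, by omega, y, Or.inl hy, hyU⟩
  | sim L h ih =>
    obtain ⟨h1, h2⟩ := ih
    refine ⟨?_, ?_⟩
    · simp only [Block.assigned_sim]
      exact Finset.union_subset_union subset_rfl h1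
    · simp only [Block.weight, Block.count, Block.assigned_sim, Finset.mem_union]
      rcases h2 with h2 | ⟨h2, h3, y, hy, hyU⟩
      · left; omega
      · exact Or.inr ⟨by omega, by omega, y, Or.inr hy, hyU⟩
  | assign | ifThenBranch | ifThenTail | ifElseLeft | ifElseRight | ifElseTail =>
    rename_i ih
    obtain ⟨h1, h2⟩ := ih
    refine ⟨?_, ?_⟩
    · intro z hz
      have := @h1 z
      simp only [Block.assigned, Finset.mem_insert, Finset.mem_union] at hz ⊢
      tauto
    · simp only [Block.weight, Block.count, Block.assigned, Finset.mem_insert, Finset.mem_union]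
      rcases h2 with h2 | ⟨h2, h3, y, hy, hyU⟩
      · left; omega
      · exact Or.inr ⟨by omega, by omega, y, by tauto, hyU⟩

/-- Here `U` contains the old variables, so a variable outside of `U` is a new one. -/
theorem card_assigned_lt {U : Finset Var} {b b' : Block} (h : b.assigned ⊆ b'.assigned)
    (hU : b.assigned ⊆ U) (hy : ∃ y ∈ b'.assigned, y ∉ U) :
    b.assigned.card < b'.assigned.card := by
  obtain ⟨y, hy, hyU⟩ := hy
  exact Finset.card_lt_card ⟨h, fun hs => hyU (hU (hs hy))⟩

/-- The termination measure, ordered lexicographically: the weight, and the number of assignments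
in excess of the number of assigned variables. By `Block.card_assigned_le_count` the subtractions do
not truncate. -/
def Program.measure (P : Program) : ℕ × ℕ :=
  (P.init.weight + P.body.weight,
    (P.init.count - P.init.assigned.card) + (P.body.count - P.body.assigned.card))

theorem Program.Step.measure_lt {P Q : Program} (h : P.Step Q) :
    Prod.Lex (· < ·) (· < ·) Q.measure P.measure := by
  have hi : P.init.assigned ⊆ P.allVars :=
    P.init.assigned_subset_vars.trans Finset.subset_union_left
  have hb : P.body.assigned ⊆ P.allVars :=
    P.body.assigned_subset_vars.trans Finset.subset_union_right
  have ci := P.init.card_assigned_le_count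
  have cb := P.body.card_assigned_le_count
  rw [Prod.lex_def]
  cases h with
  | @init b h =>
    obtain ⟨h1, h2⟩ := h.progress
    have c := b.card_assigned_le_count
    simp only [Program.measure]
    rcases h2 with h2 | ⟨h2, h3, hy⟩
    · left; omega
    · have := card_assigned_lt h1 hi hy
      omega
  | @body b h =>
    obtain ⟨h1, h2⟩ := h.progress
    have c := b.card_assigned_le_count
    simp only [Program.measure]
    rcases h2 with h2 | ⟨h2, h3, hy⟩
    · left; omega
    · have := card_assigned_lt h1 hb hy
      omega

theorem Program.wellFounded_step : WellFounded fun Q P : Program => P.Step Q :=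
  Subrelation.wf (fun h => h.measure_lt)
    (InvImage.wf Program.measure (WellFounded.prod_lex wellFounded_lt wellFounded_lt))

theorem Program.not_exists_infinite_steps (P : Program) :
    ¬ ∃ f : ℕ → Program, f 0 = P ∧ ∀ n, (f n).Step (f (n + 1)) := by
  rintro ⟨f, -, hf⟩
  obtain ⟨n, hn⟩ := WellFounded.not_rel_apply_succ (r := fun Q P : Program => P.Step Q)
    (h := ⟨Program.wellFounded_step⟩) f
  exact hn (hf n)

/-! ### The procedure -/

theorem Block.eq_of_findAssign {x : Var} {b pre post : Block} {v : Rhs} {C : BExp} {d : Var}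
    (h : b.findAssign x = some (pre, v, C, d, post)) : b = pre.append (.assign x v C d post) := by
  induction b generalizing pre with
  | nil => simp [Block.findAssign] at h
  | assign y v' C' d' r ih =>
    rw [Block.findAssign] at h
    split_ifs at h with hy
    · simp only [Option.some.injEq, Prod.mk.injEq] at h
      obtain ⟨rfl, rfl, rfl, rfl, rfl⟩ := h
      rw [hy]; rfl
    · obtain ⟨⟨pre', q⟩, hq, hq'⟩ := Option.map_eq_some_iff.1 h
      simp only [Prod.mk.injEq] at hq'
      obtain ⟨rfl, rfl⟩ := hq'
      rw [ih hq]; rfl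
  | sim | ifThen | ifElse =>
    rename_i ih
    rw [Block.findAssign] at h
    obtain ⟨⟨pre', q⟩, hq, hq'⟩ := Option.map_eq_some_iff.1 h
    simp only [Prod.mk.injEq] at hq'
    obtain ⟨rfl, rfl⟩ := hq'
    rw [ih hq]; rfl

theorem Block.findAssign_append_assign (x : Var) (pre post : Block) (v : Rhs) (C : BExp) (d : Var) :
    (pre.append (.assign x v C d post)).findAssign x ≠ none := by
  induction pre with
  | nil => simp [Block.append, Block.findAssign]
  | assign y v' C' d' r ih =>
    simp only [Block.append, Block.findAssign]
    split_ifs <;> simp [ih]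
  | sim | ifThen | ifElse => simp_all [Block.append, Block.findAssign]

theorem multiOld_eq_append (x : Var) (L : List Item) (v : Rhs) (C : BExp) (d : Var) :
    ∃ pre, multiOld x L v C d = .append pre (.assign x v C d .nil) := by
  induction L with
  | nil => exact ⟨.nil, rfl⟩
  | cons i L ih =>
    obtain ⟨pre, h⟩ := ih
    exact ⟨.assign x i.v i.C i.d (i.rest.append pre), by
      simp [multiOld, h, Block.append, Block.append_assoc]⟩

/-- Whatever `Block.next` returns results from one transformation. In particular, the
multi-assignment transformation is applied to two assignments at a time: the first one to a
variable, and the next one to the same variable in the same list. -/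
theorem Block.step_of_next {U : Finset Var} {m : Var} (hm : ∀ z ∈ U, z < m) {b b' : Block}
    (h : b.next m = some b') : BlockStep U b b' := by
  have hU : ∀ k, m + k ∉ U := fun k hk => by
    have := hm _ hk
    exact absurd this (not_lt.2 (Nat.le_add_right m k))
  induction b generalizing b' with
  | nil => simp [Block.next] at h
  | assign x v C d r ih =>
    rw [Block.next] at h
    split at h
    · rename_i w u hs
      obtain rfl := Option.some.inj h
      exact .here (old := .assign x v C d .nil) r (.dist x v C d m w u (hU 0) hs)
    · split at h
      · rename_i pre v' C' d' post hf
        obtain rfl := Option.some.inj h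
        have hr := Block.eq_of_findAssign hf
        have key := BlockStep.here post
          (Rule.multi (U := U) x [(m, ⟨v, C, d, pre⟩)] v' C' d' (by simp) (by simp)
            (by simpa using hU 0))
        rw [hr]
        simpa [multiOld, Block.append, Block.append_assoc] using key
      · obtain ⟨r', hr', rfl⟩ := Option.map_eq_some_iff.1 h
        exact .assign x v C d (ih hr')
  | sim L r ih =>
    rw [Block.next] at h
    obtain rfl := Option.some.inj h
    refine .here (old := .sim L .nil) r (.sim L _ (by simp) List.nodup_range' fun t ht => ?_)
    obtain ⟨k, -, rfl⟩ := List.mem_range'.1 ht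
    exact hU _
  | ifThen C b r ihb ihr =>
    rw [Block.next] at h
    split at h
    · rename_i b₁ hb
      obtain rfl := Option.some.inj h
      unfold ifHead at hb
      split at hb
      · rename_i x v C₂ d rest
        split_ifs at hb with hd
        obtain rfl := Option.some.inj hb
        subst hd
        exact .here (old := .ifThen C (.assign d v C₂ d rest) .nil) r (.ite C d v C₂ rest m (hU 0))
      · simp at hb
    · split at h
      · rename_i b₁ hb
        obtain rfl := Option.some.inj h
        exact .ifThenBranch C r (ihb hb)
      · obtain ⟨r', hr', rfl⟩ := Option.map_eq_some_iff.1 h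
        exact .ifThenTail C b (ihr hr')
  | ifElse C b₁ b₂ r ih₁ ih₂ ihr =>
    rw [Block.next] at h
    obtain rfl := Option.some.inj h
    refine .here (old := .ifElse C b₁ b₂ .nil) r (.els C b₁ b₂ _ _ (Finset.sort_nodup _ _)
      (fun y => ?_) (fun y _ z _ hyz => Nat.add_left_cancel hyz) fun y _ => hU y)
    simp

/-- If `Block.next` finds nothing, then no transformation applies. -/
theorem Block.not_step_of_next {U : Finset Var} {m : Var} {b b' : Block} (h : b.next m = none)
    (hs : BlockStep U b b') : False := by
  induction hs with
  | @here old new post hr =>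
    cases hr with
    | sim L ts hlen hnd hfr => simp [Block.append, Block.next] at h
    | dist x v C d t w u ht hsplit =>
      have := v.isSome_distSplit m t
      rw [hsplit, Option.isSome_some, Option.isSome_iff_exists] at this
      obtain ⟨p, hp⟩ := this
      simp [Block.append, Block.next, hp] at h
    | els C b₁ b₂ xs t hnd hxs hinj hfr => simp [Block.append, Block.next] at h
    | ite C₁ x v C₂ rest t ht => simp [Block.append, Block.next, ifHead] at h
    | multi x L v C d hL hnd hfr =>
      cases L with
      | nil => exact hL rfl
      | cons i L =>
        obtain ⟨pre, hpre⟩ := multiOld_eq_append x (L.map Prod.snd) v C d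
        simp only [List.map_cons, multiOld, hpre, Block.append, Block.append_assoc] at h
        rw [Block.next] at h
        split at h
        · simp at h
        · split at h
          · simp at h
          · rename_i hf
            rw [← Block.append_assoc] at hf
            exact Block.findAssign_append_assign _ _ _ _ _ _ hf
  | assign x v C d hr ih =>
    rw [Block.next] at h
    split at h
    · simp at h
    · split at h
      · simp at h
      · exact ih (by simpa using h)
  | sim L hr ih => simp [Block.next] at h
  | ifThenBranch C r hr ih =>
    rw [Block.next] at h
    split at h
    · simp at h
    · split at h
      · simp at h
      · rename_i hb
        exact ih hb
  | ifThenTail C b hr ih =>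
    rw [Block.next] at h
    split at h
    · simp at h
    · split at h
      · simp at h
      · exact ih (by simpa using h)
  | ifElseLeft C b₂ r hr ih => simp [Block.next] at h
  | ifElseRight C b₁ r hr ih => simp [Block.next] at h
  | ifElseTail C b₁ b₂ hr ih => simp [Block.next] at h

theorem Program.step_of_next {P Q : Program} (h : P.next = some Q) : P.Step Q := by
  have hm : ∀ z ∈ P.allVars, z < P.allVars.sup id + 1 := fun z hz =>
    Nat.lt_succ_of_le (Finset.le_sup (f := id) hz)
  unfold Program.next at h
  dsimp only at h
  split at h
  · rename_i b hb
    obtain rfl := Option.some.inj h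
    exact .init (Block.step_of_next hm hb)
  · obtain ⟨b, hb, rfl⟩ := Option.map_eq_some_iff.1 h
    exact .body (Block.step_of_next hm hb)

theorem Program.next_eq_none_iff (P : Program) : P.next = none ↔ P.NormalForm := by
  refine ⟨fun h Q hQ => ?_, fun h => ?_⟩
  · unfold Program.next at h
    dsimp only at h
    split at h
    · simp at h
    · rename_i hi
      cases hQ with
      | init hs => exact Block.not_step_of_next hi hs
      | body hs => exact Block.not_step_of_next (Option.map_eq_none_iff.1 h) hs
  · by_contra hn
    obtain ⟨Q, hQ⟩ := Option.ne_none_iff_exists'.1 hn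
    exact h Q (Program.step_of_next hQ)

theorem Program.exists_iterate_next (P : Program) :
    ∃ k : ℕ, Relation.ReflTransGen Program.Step P ((fun Q : Program => Q.next.getD Q)^[k] P) ∧
      ((fun Q : Program => Q.next.getD Q)^[k] P).NormalForm := by
  induction P using Program.wellFounded_step.induction with
  | _ P ih =>
    cases hP : P.next with
    | none => exact ⟨0, .refl, P.next_eq_none_iff.1 hP⟩
    | some Q =>
      have hs := Program.step_of_next hP
      obtain ⟨k, h1, h2⟩ := ih Q hs
      refine ⟨k + 1, ?_, ?_⟩
      · simpa [Function.iterate_succ_apply, hP] using Relation.ReflTransGen.head hs h1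
      · simpa [Function.iterate_succ_apply, hP] using h2

section Semantics

open scoped Classical

/-! ### Evaluation under renaming -/

theorem Poly.eval_rename (ρ : SymVal) (f : Var → Var) (p : Poly) (s : State) :
    (p.rename f).eval ρ s = p.eval ρ (s ∘ f) := by
  induction p <;> simp_all [Poly.rename, Poly.eval]

theorem Poly.eval_congr (ρ : SymVal) {p : Poly} {s s' : State} (h : ∀ z ∈ p.vars, s z = s' z) :
    p.eval ρ s = p.eval ρ s' := by
  induction p with
  | const c => rfl
  | var x => exact h x (by simp [Poly.vars])
  | add p q hp hq | sub p q hp hq | mul p q hp hq =>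
    simp only [Poly.vars, Finset.mem_union] at h
    simp only [Poly.eval, hp fun z hz => h z (Or.inl hz), hq fun z hz => h z (Or.inr hz)]
  | pow p n hp => simp only [Poly.eval, hp h]

theorem BExp.holds_rename (ρ : SymVal) (f : Var → Var) (C : BExp) (s : State) :
    (C.rename f).Holds ρ s ↔ C.Holds ρ (s ∘ f) := by
  induction C <;> simp_all [BExp.rename, BExp.Holds, Poly.eval_rename]

theorem BExp.holds_congr (ρ : SymVal) {C : BExp} {s s' : State} (h : ∀ z ∈ C.vars, s z = s' z) :
    C.Holds ρ s ↔ C.Holds ρ s' := by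
  induction C with
  | tt | ff => rfl
  | not C hC => simp only [BExp.Holds, hC h]
  | and C D hC hD | or C D hC hD =>
    simp only [BExp.vars, Finset.mem_union] at h
    simp only [BExp.Holds, hC fun z hz => h z (Or.inl hz), hD fun z hz => h z (Or.inr hz)]
  | eq p q | ne p q | lt p q | gt p q | ge p q | le p q =>
    simp only [BExp.vars, Finset.mem_union] at h
    simp only [BExp.Holds, Poly.eval_congr ρ fun z hz => h z (Or.inl hz),
      Poly.eval_congr ρ fun z hz => h z (Or.inr hz)]

theorem Rhs.mem_vars_cat (L : List (Poly × Const)) (p : Poly) (o : Option Const) (z : Var) :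
    z ∈ (Rhs.cat L p o).vars ↔ (∃ c ∈ L, z ∈ c.1.vars) ∨ z ∈ p.vars := by
  induction L with
  | nil => simp [Rhs.vars]
  | cons c L ih =>
    simp only [Rhs.vars, List.foldr_cons, Finset.mem_union, List.exists_mem_cons_iff] at ih ⊢
    simp only [ih, or_assoc]

theorem lastProb_map (ρ : SymVal) (L : List (Poly × Const)) (g : Poly × Const → Poly × Const)
    (hg : ∀ c, (g c).2 = c.2) (o : Option Const) : lastProb ρ (L.map g) o = lastProb ρ L o := by
  cases o <;> simp [lastProb, Function.comp_def, hg]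

theorem Rhs.valid_rename (ρ : SymVal) (f : Var → Var) (v : Rhs) (s : State) :
    (v.rename f).Valid ρ s ↔ v.Valid ρ (s ∘ f) := by
  cases v with
  | cat L p o =>
    simp only [Rhs.rename, Rhs.Valid, lastProb_map ρ L (fun c => (c.1.rename f, c.2)) fun _ => rfl]
    simp only [List.forall_mem_map, List.map_map, Function.comp_def]
  | _ => simp [Rhs.rename, Rhs.Valid, Poly.eval_rename]

theorem Rhs.rawLaw_rename (ρ : SymVal) (f : Var → Var) (v : Rhs) (s : State) :
    (v.rename f).rawLaw ρ s = v.rawLaw ρ (s ∘ f) := by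
  cases v with
  | cat L p o =>
    simp only [Rhs.rename, Rhs.rawLaw, lastProb_map ρ L (fun c => (c.1.rename f, c.2)) fun _ => rfl]
    simp [Function.comp_def, Poly.eval_rename]
  | _ => simp [Rhs.rename, Rhs.rawLaw, Poly.eval_rename]

theorem Rhs.law_rename (ρ : SymVal) (f : Var → Var) (v : Rhs) (s : State) :
    (v.rename f).law ρ s = v.law ρ (s ∘ f) := by
  simp only [Rhs.law, Rhs.valid_rename, Rhs.rawLaw_rename]

theorem Rhs.valid_congr (ρ : SymVal) {v : Rhs} {s s' : State} (h : ∀ z ∈ v.vars, s z = s' z) :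
    v.Valid ρ s ↔ v.Valid ρ s' := by
  cases v with
  | cat L p o => rfl
  | other k D args => rfl
  | bernoulli p | exponential p | expQuot c p => simp only [Rhs.Valid, Poly.eval_congr ρ h]
  | normal p q | uniform p q | laplace p q =>
    simp only [Rhs.vars, Finset.mem_union] at h
    simp only [Rhs.Valid, Poly.eval_congr ρ fun z hz => h z (Or.inl hz),
      Poly.eval_congr ρ fun z hz => h z (Or.inr hz)]

theorem Rhs.rawLaw_congr (ρ : SymVal) {v : Rhs} {s s' : State} (h : ∀ z ∈ v.vars, s z = s' z) :
    v.rawLaw ρ s = v.rawLaw ρ s' := by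
  cases v with
  | cat L p o =>
    simp only [Rhs.mem_vars_cat] at h
    simp only [Rhs.rawLaw, Poly.eval_congr ρ fun z hz => h z (Or.inr hz)]
    congr 2
    exact List.map_congr_left fun c hc => by
      rw [Poly.eval_congr ρ fun z hz => h z (Or.inl ⟨c, hc, hz⟩)]
  | other k D args =>
    have : (fun i => (args i).eval ρ s) = fun i => (args i).eval ρ s' := by
      funext i
      refine Poly.eval_congr ρ fun z hz => h z ?_
      simp only [Rhs.vars, Finset.mem_biUnion, Finset.mem_univ, true_and]
      exact ⟨i, hz⟩
    simp only [Rhs.rawLaw, this]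
  | bernoulli p | exponential p | expQuot c p => simp only [Rhs.rawLaw, Poly.eval_congr ρ h]
  | normal p q | uniform p q | laplace p q =>
    simp only [Rhs.vars, Finset.mem_union] at h
    simp only [Rhs.rawLaw, Poly.eval_congr ρ fun z hz => h z (Or.inl hz),
      Poly.eval_congr ρ fun z hz => h z (Or.inr hz)]

theorem Rhs.law_congr (ρ : SymVal) {v : Rhs} {s s' : State} (h : ∀ z ∈ v.vars, s z = s' z) :
    v.law ρ s = v.law ρ s' := by
  simp only [Rhs.law, Rhs.valid_congr ρ h, Rhs.rawLaw_congr ρ h]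

theorem Rhs.valid_ofPoly (ρ : SymVal) (p : Poly) (s : State) : (Rhs.ofPoly p).Valid ρ s := by
  simp [Rhs.ofPoly, Rhs.Valid, lastProb]

theorem Rhs.law_ofPoly (ρ : SymVal) (p : Poly) (s : State) :
    (Rhs.ofPoly p).law ρ s = Measure.dirac (p.eval ρ s) := by
  rw [Rhs.law, if_pos (Rhs.valid_ofPoly ρ p s)]
  simp [Rhs.ofPoly, Rhs.rawLaw, lastProb]

instance (ρ : SymVal) (v : Rhs) (s : State) : IsProbabilityMeasure (v.law ρ s) :=
  (inferInstance : IsProbabilityMeasure (v.kernel ρ s))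

/-! ### Execution of statement lists -/

theorem storeKernel_apply (ρ : SymVal) (x : Var) (v : Rhs) (s : State) :
    storeKernel ρ x v s = (v.law ρ s).map (Function.update s x) := by
  rw [storeKernel, Kernel.map_apply _ (measurable_store x), Kernel.prod_apply, Kernel.id_apply,
    Measure.dirac_prod, Measure.map_map (measurable_store x) measurable_prodMk_left]
  rfl

theorem assignKernel_of_holds {ρ : SymVal} {x : Var} {v : Rhs} {C : BExp} {d : Var} {s : State}
    (h : C.Holds ρ s) : assignKernel ρ x v C d s = (v.law ρ s).map (Function.update s x) := by
  rw [assignKernel, Kernel.piecewise_apply, if_pos (by exact h), storeKernel_apply]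

theorem assignKernel_of_not_holds {ρ : SymVal} {x : Var} {v : Rhs} {C : BExp} {d : Var}
    {s : State} (h : ¬ C.Holds ρ s) :
    assignKernel ρ x v C d s = Measure.dirac (Function.update s x (s d)) := by
  rw [assignKernel, Kernel.piecewise_apply, if_neg (by exact h), Kernel.deterministic_apply]

theorem Block.kernel_nil (ρ : SymVal) (s : State) : Block.nil.kernel ρ s = Measure.dirac s :=
  Kernel.id_apply s

theorem Block.kernel_assign (ρ : SymVal) (x : Var) (v : Rhs) (C : BExp) (d : Var) (r : Block)
    (s : State) :
    (Block.assign x v C d r).kernel ρ s = (assignKernel ρ x v C d s).bind (r.kernel ρ) :=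
  Kernel.comp_apply _ _ _

theorem Block.kernel_append (ρ : SymVal) (a b : Block) :
    (a.append b).kernel ρ = b.kernel ρ ∘ₖ a.kernel ρ := by
  induction a with
  | nil => exact (Kernel.comp_id _).symm
  | assign | sim | ifThen | ifElse => simp_all [Block.append, Block.kernel, Kernel.comp_assoc]

theorem Block.kernel_append_apply (ρ : SymVal) (a b : Block) (s : State) :
    (a.append b).kernel ρ s = (a.kernel ρ s).bind (b.kernel ρ) := by
  rw [Block.kernel_append, Kernel.comp_apply]

theorem Block.kernel_ifThen_of_holds {ρ : SymVal} {C : BExp} {b r : Block} {s : State}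
    (h : C.Holds ρ s) : (Block.ifThen C b r).kernel ρ s = (b.append r).kernel ρ s := by
  rw [Block.kernel_append_apply, Block.kernel, Kernel.comp_apply, Kernel.piecewise_apply,
    if_pos (by exact h)]

theorem Block.kernel_ifThen_of_not_holds {ρ : SymVal} {C : BExp} {b r : Block} {s : State}
    (h : ¬ C.Holds ρ s) : (Block.ifThen C b r).kernel ρ s = r.kernel ρ s := by
  rw [Block.kernel, Kernel.comp_apply, Kernel.piecewise_apply, if_neg (by exact h),
    Kernel.id_apply, Measure.dirac_bind (Kernel.measurable _)]

theorem Block.kernel_ifElse_of_holds {ρ : SymVal} {C : BExp} {b₁ b₂ r : Block} {s : State}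
    (h : C.Holds ρ s) : (Block.ifElse C b₁ b₂ r).kernel ρ s = (b₁.append r).kernel ρ s := by
  rw [Block.kernel_append_apply, Block.kernel, Kernel.comp_apply, Kernel.piecewise_apply,
    if_pos (by exact h)]

theorem Block.kernel_ifElse_of_not_holds {ρ : SymVal} {C : BExp} {b₁ b₂ r : Block} {s : State}
    (h : ¬ C.Holds ρ s) : (Block.ifElse C b₁ b₂ r).kernel ρ s = (b₂.append r).kernel ρ s := by
  rw [Block.kernel_append_apply, Block.kernel, Kernel.comp_apply, Kernel.piecewise_apply,
    if_neg (by exact h)]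

theorem measurableSet_ae_kernel {α β : Type*} [MeasurableSpace α] [MeasurableSpace β]
    (κ : Kernel α β) {Q : β → Prop} (hQ : MeasurableSet {y | Q y}) :
    MeasurableSet {a | ∀ᵐ y ∂κ a, Q y} := by
  simp only [ae_iff]
  exact Kernel.measurable_coe κ hQ.compl (measurableSet_singleton 0)

theorem Block.measurableSet_safe (ρ : SymVal) (b : Block) : MeasurableSet {s | b.Safe ρ s} := by
  have imp : ∀ {C D : State → Prop}, MeasurableSet {s | C s} → MeasurableSet {s | D s} →
      MeasurableSet {s | C s → D s} := fun {C D} hC hD => by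
    simp only [imp_iff_not_or]
    exact hC.compl.union hD
  induction b with
  | nil => exact MeasurableSet.univ
  | assign x v C d r ih =>
    exact (imp (C.measurableSet_holds ρ) (v.measurableSet_valid ρ)).inter
      (measurableSet_ae_kernel _ ih)
  | sim L r ih =>
    refine MeasurableSet.inter ?_ (measurableSet_ae_kernel _ ih)
    change MeasurableSet {s | ∀ c ∈ L, c.2.Valid ρ s}
    induction L with
    | nil => simp
    | cons c L ih' =>
      simp only [List.forall_mem_cons]
      exact (c.2.measurableSet_valid ρ).inter ih'
  | ifThen C b r ihb ihr =>
    exact (imp (C.measurableSet_holds ρ) ihb).inter (measurableSet_ae_kernel _ ihr)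
  | ifElse C b₁ b₂ r ih₁ ih₂ ihr =>
    exact (imp (C.measurableSet_holds ρ) ih₁).inter
      ((imp (C.measurableSet_holds ρ).compl ih₂).inter (measurableSet_ae_kernel _ ihr))

theorem ae_bind_iff {α β : Type*} [MeasurableSpace α] [MeasurableSpace β] {μ : Measure α}
    {κ : Kernel α β} {Q : β → Prop} (hQ : MeasurableSet {y | Q y}) :
    (∀ᵐ y ∂μ.bind κ, Q y) ↔ ∀ᵐ a ∂μ, ∀ᵐ y ∂κ a, Q y :=
  Measure.ae_comp_iff hQ

theorem Block.safe_append (ρ : SymVal) (a b : Block) (s : State) :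
    (a.append b).Safe ρ s ↔ a.Safe ρ s ∧ ∀ᵐ y ∂a.kernel ρ s, b.Safe ρ y := by
  have hb := b.measurableSet_safe ρ
  induction a generalizing s with
  | nil =>
    rw [Block.kernel_nil, ae_dirac_iff hb]
    simp [Block.append, Block.Safe]
  | assign x v C d r ih =>
    rw [Block.kernel_assign, ae_bind_iff hb]
    simp only [Block.append, Block.Safe, ih, Filter.eventually_and, and_assoc]
  | sim L r ih =>
    rw [Block.kernel, Kernel.comp_apply, ae_bind_iff hb]
    simp only [Block.append, Block.Safe, ih, Filter.eventually_and, and_assoc]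
  | ifThen C b r ihb ih =>
    rw [Block.kernel, Kernel.comp_apply, ae_bind_iff hb]
    simp only [Block.append, Block.Safe, ih, Filter.eventually_and, and_assoc]
  | ifElse C b₁ b₂ r ih₁ ih₂ ih =>
    rw [Block.kernel, Kernel.comp_apply, ae_bind_iff hb]
    simp only [Block.append, Block.Safe, ih, Filter.eventually_and, and_assoc]

theorem Block.safe_ifThen_of_holds {ρ : SymVal} {C : BExp} {b r : Block} {s : State}
    (h : C.Holds ρ s) : (Block.ifThen C b r).Safe ρ s ↔ (b.append r).Safe ρ s := by
  rw [Block.safe_append, Block.Safe, Kernel.piecewise_apply, if_pos (by exact h)]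
  simp [h]

theorem Block.safe_ifThen_of_not_holds {ρ : SymVal} {C : BExp} {b r : Block} {s : State}
    (h : ¬ C.Holds ρ s) : (Block.ifThen C b r).Safe ρ s ↔ r.Safe ρ s := by
  rw [Block.Safe, Kernel.piecewise_apply, if_neg (by exact h), Kernel.id_apply,
    ae_dirac_iff (r.measurableSet_safe ρ)]
  simp [h]

theorem Block.safe_ifElse_of_holds {ρ : SymVal} {C : BExp} {b₁ b₂ r : Block} {s : State}
    (h : C.Holds ρ s) : (Block.ifElse C b₁ b₂ r).Safe ρ s ↔ (b₁.append r).Safe ρ s := by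
  rw [Block.safe_append, Block.Safe, Kernel.piecewise_apply, if_pos (by exact h)]
  simp [h]

theorem Block.safe_ifElse_of_not_holds {ρ : SymVal} {C : BExp} {b₁ b₂ r : Block} {s : State}
    (h : ¬ C.Holds ρ s) : (Block.ifElse C b₁ b₂ r).Safe ρ s ↔ (b₂.append r).Safe ρ s := by
  rw [Block.safe_append, Block.Safe, Kernel.piecewise_apply, if_neg (by exact h)]
  simp [h]

theorem Block.safe_assign_nil {ρ : SymVal} {x : Var} {v : Rhs} {C : BExp} {d : Var} {s : State} :
    (Block.assign x v C d .nil).Safe ρ s ↔ (C.Holds ρ s → v.Valid ρ s) := by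
  simp [Block.Safe]

theorem Block.kernel_assign_nil (ρ : SymVal) (x : Var) (v : Rhs) (C : BExp) (d : Var) :
    (Block.assign x v C d .nil).kernel ρ = assignKernel ρ x v C d :=
  Kernel.id_comp _

theorem Block.kernel_sim_nil (ρ : SymVal) (L : List (Var × Rhs)) :
    (Block.sim L .nil).kernel ρ = simKernel ρ L :=
  Kernel.id_comp _

theorem map_bind_kernel {α β γ : Type*} [MeasurableSpace α] [MeasurableSpace β]
    [MeasurableSpace γ] (μ : Measure α) {f : α → β} (hf : Measurable f) (κ : Kernel β γ) :
    (μ.map f).bind κ = μ.bind (κ ∘ f) := by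
  ext E hE
  rw [Measure.bind_apply hE κ.aemeasurable,
    Measure.bind_apply hE (κ.measurable.comp hf).aemeasurable,
    lintegral_map (Kernel.measurable_coe κ hE) hf]
  rfl

/-- A plain assignment of a polynomial is deterministic. -/
theorem Block.kernel_assign_ofPoly (ρ : SymVal) (x : Var) (p : Poly) (d : Var) (r : Block)
    (s : State) : (Block.assign x (.ofPoly p) .tt d r).kernel ρ s =
      r.kernel ρ (Function.update s x (p.eval ρ s)) := by
  rw [Block.kernel_assign, assignKernel_of_holds (by trivial), Rhs.law_ofPoly,
    Measure.map_dirac' (measurable_update s), Measure.dirac_bind (Kernel.measurable _)]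

theorem Block.safe_assign_ofPoly {ρ : SymVal} {x : Var} {p : Poly} {d : Var} {r : Block}
    {s : State} : (Block.assign x (.ofPoly p) .tt d r).Safe ρ s ↔
      r.Safe ρ (Function.update s x (p.eval ρ s)) := by
  rw [Block.Safe, assignKernel_of_holds (by trivial), Rhs.law_ofPoly,
    Measure.map_dirac' (measurable_update s), ae_dirac_iff (r.measurableSet_safe ρ)]
  simp [Rhs.valid_ofPoly]

/-! ### Unassigned variables -/

theorem measurableSet_unchanged (A : Finset Var) (s : State) :
    MeasurableSet {y : State | ∀ z ∉ A, y z = s z} := by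
  have : {y : State | ∀ z ∉ A, y z = s z} = ⋂ z, ⋂ (_ : z ∉ A), {y : State | y z = s z} := by
    ext; simp
  rw [this]
  exact MeasurableSet.iInter fun z => MeasurableSet.iInter fun _ =>
    measurableSet_eq_fun (measurable_pi_apply z) measurable_const

theorem ae_assignKernel_unchanged (ρ : SymVal) (x : Var) (v : Rhs) (C : BExp) (d : Var)
    (s : State) : ∀ᵐ y ∂assignKernel ρ x v C d s, ∀ z ∉ ({x} : Finset Var), y z = s z := by
  have hm := measurableSet_unchanged {x} s
  by_cases h : C.Holds ρ s
  · rw [assignKernel_of_holds h, ae_map_iff (measurable_update s).aemeasurable hm]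
    refine Filter.Eventually.of_forall fun r z hz => ?_
    rw [Function.update_of_ne (by simpa using hz)]
  · rw [assignKernel_of_not_holds h, ae_dirac_iff hm]
    intro z hz
    rw [Function.update_of_ne (by simpa using hz)]

theorem drawKernel_apply (ρ : SymVal) (x : Var) (v : Rhs) (q : State × State) :
    drawKernel ρ x v q = (v.law ρ q.1).map fun r => (q.1, Function.update q.2 x r) := by
  rw [drawKernel, Kernel.map_apply _ (measurable_drawUpdate x), Kernel.prod_apply, Kernel.id_apply,
    Measure.dirac_prod, Measure.map_map (measurable_drawUpdate x) measurable_prodMk_left]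
  rfl

/-- The law of the updated state after the draws of a simultaneous assignment, where `s` is the
state in which the right-hand sides are evaluated, and `s'` is the state that is updated. -/
noncomputable def drawsLaw (ρ : SymVal) (L : List (Var × Rhs)) (s s' : State) : Measure State :=
  (drawsKernel ρ L (s, s')).map Prod.snd

theorem simKernel_apply (ρ : SymVal) (L : List (Var × Rhs)) (s : State) :
    simKernel ρ L s = drawsLaw ρ L s s := by
  rw [simKernel, Kernel.map_apply _ measurable_snd, Kernel.comap_apply]
  rfl

theorem drawsLaw_nil (ρ : SymVal) (s s' : State) : drawsLaw ρ [] s s' = Measure.dirac s' := by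
  rw [drawsLaw, drawsKernel, Kernel.id_apply, Measure.map_dirac' measurable_snd]

theorem drawsLaw_cons_apply (ρ : SymVal) (x : Var) (v : Rhs) (L : List (Var × Rhs)) (s s' : State)
    {E : Set State} (hE : MeasurableSet E) :
    drawsLaw ρ ((x, v) :: L) s s' E =
      ∫⁻ r, drawsLaw ρ L s (Function.update s' x r) E ∂v.law ρ s := by
  have h : Measurable fun r => (s, Function.update s' x r) :=
    measurable_const.prodMk (measurable_update s')
  have hE' : MeasurableSet (Prod.snd ⁻¹' E : Set (State × State)) := measurable_snd hE
  simp only [drawsLaw, Measure.map_apply measurable_snd hE]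
  rw [drawsKernel, Kernel.comp_apply, drawKernel_apply, map_bind_kernel _ h,
    Measure.bind_apply hE' ((drawsKernel ρ L).measurable.comp h).aemeasurable]
  rfl

theorem ae_drawsLaw_unchanged (ρ : SymVal) (L : List (Var × Rhs)) (A : Finset Var)
    (hA : ∀ c ∈ L, c.1 ∈ A) (s s' s₀ : State) (hs : ∀ z ∉ A, s' z = s₀ z) :
    ∀ᵐ y ∂drawsLaw ρ L s s', ∀ z ∉ A, y z = s₀ z := by
  have hm := measurableSet_unchanged A s₀
  induction L generalizing s' with
  | nil =>
    rw [drawsLaw_nil, ae_dirac_iff hm]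
    exact hs
  | cons c L ih =>
    obtain ⟨x, v⟩ := c
    rw [ae_iff]
    change drawsLaw ρ ((x, v) :: L) s s' {y | ∀ z ∉ A, y z = s₀ z}ᶜ = 0
    rw [drawsLaw_cons_apply _ _ _ _ _ _ hm.compl]
    refine lintegral_eq_zero_of_ae_eq_zero (Filter.Eventually.of_forall fun r => ?_)
    refine ae_iff.1 (ih (fun c hc => hA c (List.mem_cons_of_mem _ hc)) _ fun z hz => ?_)
    rw [Function.update_of_ne, hs z hz]
    rintro rfl
    exact hz (hA (z, v) List.mem_cons_self)

/-- Almost surely, the execution of a statement list changes only the variables that are assigned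
in it. -/
theorem Block.ae_unchanged (ρ : SymVal) (b : Block) (s : State) :
    ∀ᵐ y ∂b.kernel ρ s, ∀ z ∉ b.assigned, y z = s z := by
  -- The composition of two executions that leave the variables outside of `A` unchanged.
  have comp : ∀ {μ : Measure State} {r : Block} {A : Finset Var} {s : State}, r.assigned ⊆ A →
      (∀ s, ∀ᵐ y ∂r.kernel ρ s, ∀ z ∉ r.assigned, y z = s z) →
      (∀ᵐ y ∂μ, ∀ z ∉ A, y z = s z) → ∀ᵐ y ∂μ.bind (r.kernel ρ), ∀ z ∉ A, y z = s z := by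
    intro μ r A s hA hr hμ
    rw [ae_bind_iff (measurableSet_unchanged A s)]
    filter_upwards [hμ] with a ha
    filter_upwards [hr a] with y hy z hz
    rw [hy z fun h => hz (hA h), ha z hz]
  induction b generalizing s with
  | nil =>
    rw [Block.kernel_nil, ae_dirac_iff (measurableSet_unchanged _ s)]
    exact fun _ _ => rfl
  | assign x v C d r ih =>
    rw [Block.kernel_assign]
    refine comp (Finset.subset_insert _ _) ih ?_
    filter_upwards [ae_assignKernel_unchanged ρ x v C d s] with y hy z hz
    exact hy z fun h => hz (by rw [Finset.mem_singleton.1 h]; exact Finset.mem_insert_self _ _)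
  | sim L r ih =>
    rw [Block.kernel, Kernel.comp_apply, simKernel_apply]
    refine comp ?_ ih (ae_drawsLaw_unchanged ρ L _ (fun c hc => ?_) s s s fun _ _ => rfl)
    · rw [Block.assigned_sim]
      exact Finset.subset_union_right
    · rw [Block.assigned_sim, Finset.mem_union, List.mem_toFinset]
      exact Or.inl (List.mem_map_of_mem hc)
  | ifThen C b r ihb ih =>
    rw [Block.kernel, Kernel.comp_apply, Kernel.piecewise_apply]
    refine comp Finset.subset_union_right ih ?_
    split_ifs
    · filter_upwards [ihb s] with y hy z hz
      exact hy z fun h => hz (Finset.mem_union_left _ h)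
    · rw [Kernel.id_apply, ae_dirac_iff (measurableSet_unchanged _ s)]
      exact fun _ _ => rfl
  | ifElse C b₁ b₂ r ih₁ ih₂ ih =>
    rw [Block.kernel, Kernel.comp_apply, Kernel.piecewise_apply]
    refine comp Finset.subset_union_right ih ?_
    split_ifs
    · filter_upwards [ih₁ s] with y hy z hz
      exact hy z fun h => hz (Finset.mem_union_left _ (Finset.mem_union_left _ h))
    · filter_upwards [ih₂ s] with y hy z hz
      exact hy z fun h => hz (Finset.mem_union_left _ (Finset.mem_union_right _ h))

/-! ### Refinement of statement lists -/

/-- The values that the variables in `U` have in the state `s`, where the variable `z` is stored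
under the name `f z`. -/
def view (U : Finset Var) (f : Var → Var) (s : State) : U → ℝ := fun z => s (f z)

theorem measurable_view (U : Finset Var) (f : Var → Var) : Measurable (view U f) :=
  measurable_pi_lambda _ fun z => measurable_pi_apply (f z)

theorem view_eq_view {U : Finset Var} {f g : Var → Var} {s s' : State} :
    view U f s = view U g s' ↔ ∀ z ∈ U, s (f z) = s' (g z) := by
  simp [view, funext_iff]

/-- The state in which the variables in `U` have given values, and all other variables are `0`. -/
noncomputable def extend (U : Finset Var) (u : U → ℝ) : State :=
  fun z => if h : z ∈ U then u ⟨z, h⟩ else 0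

theorem measurable_extend (U : Finset Var) : Measurable (extend U) := by
  refine measurable_pi_lambda _ fun z => ?_
  unfold extend
  split_ifs
  · exact measurable_pi_apply _
  · exact measurable_const

theorem view_extend (U : Finset Var) (u : U → ℝ) : view U id (extend U u) = u := by
  funext z
  simp [view, extend]

/-- Composition of a pair of measures with a pair of kernels. The measures `μ` and `μ'` agree as
seen through `p` and `q`, and the kernels agree, as seen through `p₂` and `q₂`, from any two points
with the same image under `p` and `q`, provided that `Q` holds at the first of them. Then the
compositions agree as seen through `p₂` and `q₂`. The section `ι` of `p` translates properties of
points that hold almost surely under `μ` to properties that hold almost surely under `μ'`. -/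
theorem bind_transfer {S S' T T' A B : Type*} [MeasurableSpace S] [MeasurableSpace S']
    [MeasurableSpace T] [MeasurableSpace T'] [MeasurableSpace A] [MeasurableSpace B]
    {μ : Measure S} {μ' : Measure S'} {p : S → A} {q : S' → A} {p₂ : T → B} {q₂ : T' → B}
    (hp : Measurable p) (hq : Measurable q) (hp₂ : Measurable p₂) (hq₂ : Measurable q₂)
    {ι : A → S} (hι : Measurable ι) (hpι : ∀ a, p (ι a) = a) (h : μ.map p = μ'.map q)
    (η : Kernel S T) (η' : Kernel S' T') {Q : S → Prop} {Q' : S' → Prop}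
    (hQm : MeasurableSet {s | Q s})
    (hinv : ∀ s s₁, p s = p s₁ → Q s → Q s₁ ∧ (η s).map p₂ = (η s₁).map p₂)
    (hstep : ∀ s s', p s = q s' → Q s → Q' s' ∧ (η s).map p₂ = (η' s').map q₂)
    (hQ : ∀ᵐ s ∂μ, Q s) :
    (∀ᵐ s' ∂μ', Q' s') ∧ (μ.bind η).map p₂ = (μ'.bind η').map q₂ := by
  have hA : ∀ᵐ a ∂μ.map p, Q (ι a) :=
    (ae_map_iff hp.aemeasurable (hι hQm)).2 (hQ.mono fun s hs => (hinv s _ (hpι _).symm hs).1)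
  have hA' : ∀ᵐ s' ∂μ', Q (ι (q s')) := ae_of_ae_map hq.aemeasurable (h ▸ hA)
  refine ⟨hA'.mono fun s' hs' => (hstep _ s' (hpι _) hs').1, ?_⟩
  ext E hE
  have hF : Measurable fun a => η (ι a) (p₂ ⁻¹' E) := (Kernel.measurable_coe η (hp₂ hE)).comp hι
  rw [Measure.map_apply hp₂ hE, Measure.map_apply hq₂ hE,
    Measure.bind_apply (hp₂ hE) η.aemeasurable, Measure.bind_apply (hq₂ hE) η'.aemeasurable]
  calc ∫⁻ s, η s (p₂ ⁻¹' E) ∂μ = ∫⁻ s, η (ι (p s)) (p₂ ⁻¹' E) ∂μ := by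
        refine lintegral_congr_ae (hQ.mono fun s hs => ?_)
        have := (hinv s _ (hpι _).symm hs).2
        simp only [← Measure.map_apply hp₂ hE, this]
    _ = ∫⁻ a, η (ι a) (p₂ ⁻¹' E) ∂μ.map p := (lintegral_map hF hp).symm
    _ = ∫⁻ s', η (ι (q s')) (p₂ ⁻¹' E) ∂μ' := by rw [h, lintegral_map hF hq]
    _ = ∫⁻ s', η' s' (q₂ ⁻¹' E) ∂μ' := by
        refine lintegral_congr_ae (hA'.mono fun s' hs' => ?_)
        have := (hstep _ s' (hpι _) hs').2
        simp only [← Measure.map_apply hp₂ hE, ← Measure.map_apply hq₂ hE, this]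

/-- `Block.Refines ρ U f g b b'`: as far as the variables in `U` are concerned, `b'` behaves like
`b` whenever `b` is safe. Before the execution, the value of the variable `z` in the state of `b` is
stored under the name `f z` in the state of `b'`; after the execution, under the name `g z`. -/
def Block.Refines (ρ : SymVal) (U : Finset Var) (f g : Var → Var) (b b' : Block) : Prop :=
  ∀ s s', view U id s = view U f s' → b.Safe ρ s →
    b'.Safe ρ s' ∧ (b.kernel ρ s).map (view U id) = (b'.kernel ρ s').map (view U g)

/-- The second list `b` has to refine itself, so that its safety and its law depend only on the
values of the variables in `U`. -/
theorem Block.Refines.append {ρ : SymVal} {U : Finset Var} {f g h : Var → Var}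
    {a a' b b' : Block} (ha : Block.Refines ρ U f g a a') (hb : Block.Refines ρ U g h b b')
    (hself : Block.Refines ρ U id id b b) :
    Block.Refines ρ U f h (a.append b) (a'.append b') := by
  intro s s' hs hsafe
  obtain ⟨h1, h2⟩ := (Block.safe_append ρ a b s).1 hsafe
  obtain ⟨h3, h4⟩ := ha s s' hs h1
  obtain ⟨h5, h6⟩ := bind_transfer (measurable_view U id) (measurable_view U g)
    (measurable_view U id) (measurable_view U h) (measurable_extend U) (view_extend U) h4
    (b.kernel ρ) (b'.kernel ρ) (b.measurableSet_safe ρ) hself hb h2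
  rw [Block.safe_append, Block.kernel_append_apply, Block.kernel_append_apply]
  exact ⟨⟨h3, h5⟩, h6⟩

theorem Block.Refines.nil (ρ : SymVal) (U : Finset Var) (f : Var → Var) :
    Block.Refines ρ U f f .nil .nil := by
  intro s s' hs _
  refine ⟨trivial, ?_⟩
  rw [Block.kernel_nil, Block.kernel_nil, Measure.map_dirac' (measurable_view _ _),
    Measure.map_dirac' (measurable_view _ _), hs]

theorem eq_comp_of_view {U V : Finset Var} {f : Var → Var} {s s' : State}
    (h : view U id s = view U f s') (hV : V ⊆ U) : ∀ z ∈ V, s z = (s' ∘ f) z :=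
  fun z hz => view_eq_view.1 h z (hV hz)

/-- An assignment to `x` refines to an assignment to `x'`, if `x'` is the new name of `x`, and the
other names are kept and different from `x'`. -/
theorem Block.refines_assign (ρ : SymVal) {U : Finset Var} {f g : Var → Var} {x x' : Var}
    {v : Rhs} {C : BExp} {d : Var} (hU : (Block.assign x v C d .nil).vars ⊆ U) (hx : g x = x')
    (hg : ∀ z ∈ U, z ≠ x → g z = f z ∧ f z ≠ x') :
    Block.Refines ρ U f g (.assign x v C d .nil)
      (.assign x' (v.rename f) (C.rename f) (f d) .nil) := by
  intro s s' hs hsafe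
  have hvar : ∀ z, z = d ∨ z ∈ v.vars ∨ z ∈ C.vars → z ∈ U := fun z hz => hU (by
    simp only [Block.vars, Finset.mem_union, Finset.mem_insert, Finset.mem_singleton]
    tauto)
  have hC : C.Holds ρ s ↔ (C.rename f).Holds ρ s' := by
    rw [BExp.holds_rename]
    exact BExp.holds_congr ρ (eq_comp_of_view hs fun z hz => hvar z (by tauto))
  have hv : ∀ z ∈ v.vars, s z = (s' ∘ f) z := eq_comp_of_view hs fun z hz => hvar z (by tauto)
  have key : ∀ r, view U id (Function.update s x r) = view U g (Function.update s' x' r) := by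
    intro r
    refine view_eq_view.2 fun z hz => ?_
    by_cases hzx : z = x
    · subst hzx
      simp [hx]
    · obtain ⟨h1, h2⟩ := hg z hz hzx
      rw [h1, Function.update_of_ne h2, id, Function.update_of_ne hzx]
      exact view_eq_view.1 hs z hz
  rw [Block.safe_assign_nil] at hsafe ⊢
  rw [Block.kernel_assign_nil, Block.kernel_assign_nil, ← hC, Rhs.valid_rename,
    ← Rhs.valid_congr ρ hv]
  refine ⟨hsafe, ?_⟩
  by_cases h : C.Holds ρ s
  · rw [assignKernel_of_holds h, assignKernel_of_holds (hC.1 h), Rhs.law_rename,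
      ← Rhs.law_congr ρ hv, Measure.map_map (measurable_view _ _) (measurable_update s),
      Measure.map_map (measurable_view _ _) (measurable_update s')]
    exact congrArg (fun F => Measure.map F (v.law ρ s)) (funext key)
  · rw [assignKernel_of_not_holds h, assignKernel_of_not_holds fun h' => h (hC.2 h'),
      Measure.map_dirac' (measurable_view _ _), Measure.map_dirac' (measurable_view _ _), key]
    have hd : s d = s' (f d) := view_eq_view.1 hs d (hvar d (by tauto))
    rw [hd]

/-- Both the state `s₀` in which the right-hand sides are evaluated and the state `s` that is
updated are stored under the names `f`. Injectivity is needed so that an update of `x` does not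
change another variable of `U`. -/
theorem map_drawsLaw_rename (ρ : SymVal) {U : Finset Var} {f : Var → Var} (hf : Set.InjOn f U)
    (L : List (Var × Rhs)) (hL : ∀ c ∈ L, c.1 ∈ U ∧ c.2.vars ⊆ U) {s₀ s s₀' s' : State}
    (h₀ : view U id s₀ = view U f s₀') (h : view U id s = view U f s') :
    (drawsLaw ρ L s₀ s).map (view U id) =
      (drawsLaw ρ (L.map fun c => (f c.1, c.2.rename f)) s₀' s').map (view U f) := by
  induction L generalizing s s' with
  | nil =>
    rw [List.map_nil, drawsLaw_nil, drawsLaw_nil, Measure.map_dirac' (measurable_view _ _),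
      Measure.map_dirac' (measurable_view _ _), h]
  | cons c L ih =>
    obtain ⟨x, v⟩ := c
    obtain ⟨hx, hv⟩ := hL (x, v) List.mem_cons_self
    ext E hE
    have h1 := measurable_view U id hE
    have h2 := measurable_view U f hE
    rw [Measure.map_apply (measurable_view _ _) hE, Measure.map_apply (measurable_view _ _) hE,
      List.map_cons, drawsLaw_cons_apply _ _ _ _ _ _ h1, drawsLaw_cons_apply _ _ _ _ _ _ h2,
      Rhs.law_rename, ← Rhs.law_congr ρ (eq_comp_of_view h₀ hv)]
    refine lintegral_congr fun r => ?_
    rw [← Measure.map_apply (measurable_view _ _) hE, ← Measure.map_apply (measurable_view _ _) hE]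
    refine congrArg (fun ν : Measure (U → ℝ) => ν E)
      (ih (fun c hc => hL c (List.mem_cons_of_mem _ hc)) (view_eq_view.2 fun z hz => ?_))
    by_cases hzx : z = x
    · subst hzx
      simp
    · rw [id, Function.update_of_ne hzx, Function.update_of_ne fun e => hzx (hf hz hx e)]
      exact view_eq_view.1 h z hz

theorem Poly.rename_id (p : Poly) : p.rename id = p := by
  induction p <;> simp_all [Poly.rename]

theorem BExp.rename_id (C : BExp) : C.rename id = C := by
  induction C <;> simp_all [BExp.rename, Poly.rename_id]

theorem Rhs.rename_id (v : Rhs) : v.rename id = v := by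
  cases v <;> simp [Rhs.rename, Poly.rename_id]

theorem Block.rename_id (b : Block) : b.rename id = b := by
  induction b <;> simp_all [Block.rename, Rhs.rename_id, BExp.rename_id]

theorem Block.refines_ifThen (ρ : SymVal) {U : Finset Var} {f : Var → Var} {C : BExp}
    {b b' : Block} (hC : C.vars ⊆ U) (hb : Block.Refines ρ U f f b b') :
    Block.Refines ρ U f f (.ifThen C b .nil) (.ifThen (C.rename f) b' .nil) := by
  intro s s' hs hsafe
  have e : (C.rename f).Holds ρ s' ↔ C.Holds ρ s := by
    rw [BExp.holds_rename]
    exact (BExp.holds_congr ρ (eq_comp_of_view hs hC)).symm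
  by_cases h : C.Holds ρ s
  · rw [Block.kernel_ifThen_of_holds h, Block.kernel_ifThen_of_holds (e.2 h),
      Block.safe_ifThen_of_holds (e.2 h), Block.append_nil, Block.append_nil]
    rw [Block.safe_ifThen_of_holds h, Block.append_nil] at hsafe
    exact hb s s' hs hsafe
  · rw [Block.kernel_ifThen_of_not_holds h, Block.kernel_ifThen_of_not_holds (mt e.1 h),
      Block.safe_ifThen_of_not_holds (mt e.1 h)]
    exact Block.Refines.nil ρ U f s s' hs trivial

theorem Block.refines_ifElse (ρ : SymVal) {U : Finset Var} {f : Var → Var} {C : BExp}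
    {b₁ b₁' b₂ b₂' : Block} (hC : C.vars ⊆ U) (h₁ : Block.Refines ρ U f f b₁ b₁')
    (h₂ : Block.Refines ρ U f f b₂ b₂') :
    Block.Refines ρ U f f (.ifElse C b₁ b₂ .nil) (.ifElse (C.rename f) b₁' b₂' .nil) := by
  intro s s' hs hsafe
  have e : (C.rename f).Holds ρ s' ↔ C.Holds ρ s := by
    rw [BExp.holds_rename]
    exact (BExp.holds_congr ρ (eq_comp_of_view hs hC)).symm
  by_cases h : C.Holds ρ s
  · rw [Block.kernel_ifElse_of_holds h, Block.kernel_ifElse_of_holds (e.2 h),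
      Block.safe_ifElse_of_holds (e.2 h), Block.append_nil, Block.append_nil]
    rw [Block.safe_ifElse_of_holds h, Block.append_nil] at hsafe
    exact h₁ s s' hs hsafe
  · rw [Block.kernel_ifElse_of_not_holds h, Block.kernel_ifElse_of_not_holds (mt e.1 h),
      Block.safe_ifElse_of_not_holds (mt e.1 h), Block.append_nil, Block.append_nil]
    rw [Block.safe_ifElse_of_not_holds h, Block.append_nil] at hsafe
    exact h₂ s s' hs hsafe

/-- The semantics is invariant under injective renaming. -/
theorem Block.refines_rename (ρ : SymVal) {U : Finset Var} {f : Var → Var} (hf : Set.InjOn f U)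
    {b : Block} (hU : b.vars ⊆ U) : Block.Refines ρ U f f b (b.rename f) := by
  induction b generalizing f with
  | nil => exact Block.Refines.nil ρ U f
  | assign x v C d r ih =>
    have hr : r.vars ⊆ U := fun z hz => hU (by simp [Block.vars, hz])
    have h1 : (Block.assign x v C d .nil).vars ⊆ U := fun z hz => hU (by
      simp only [Block.vars, Finset.mem_union, Finset.notMem_empty, or_false] at hz ⊢
      tauto)
    have hx : x ∈ U := hU (by simp [Block.vars])
    have hs := ih Function.injective_id.injOn hr
    rw [Block.rename_id] at hs
    exact (Block.refines_assign ρ h1 rfl fun z hz hzx =>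
      ⟨rfl, fun e => hzx (hf hz hx e)⟩).append (ih hf hr) hs
  | sim L r ih =>
    have hr : r.vars ⊆ U := fun z hz => hU ((Block.mem_vars_sim L r z).2 (Or.inr hz))
    have hL : ∀ c ∈ L, c.1 ∈ U ∧ c.2.vars ⊆ U := fun c hc =>
      ⟨hU ((Block.mem_vars_sim L r _).2 (Or.inl ⟨c, hc, Or.inl rfl⟩)),
        fun z hz => hU ((Block.mem_vars_sim L r z).2 (Or.inl ⟨c, hc, Or.inr hz⟩))⟩
    have hs := ih Function.injective_id.injOn hr
    rw [Block.rename_id] at hs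
    have h1 : Block.Refines ρ U f f (.sim L .nil)
        (.sim (L.map fun c => (f c.1, c.2.rename f)) .nil) := by
      intro s s' hs hsafe
      simp only [Block.Safe, Filter.eventually_true, and_true, List.forall_mem_map,
        Rhs.valid_rename] at hsafe ⊢
      refine ⟨fun c hc => (Rhs.valid_congr ρ (eq_comp_of_view hs (hL c hc).2)).1 (hsafe c hc), ?_⟩
      rw [Block.kernel_sim_nil, Block.kernel_sim_nil, simKernel_apply, simKernel_apply]
      exact map_drawsLaw_rename ρ hf L hL hs hs
    exact h1.append (ih hf hr) hs
  | ifThen C b r ihb ih =>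
    have hr : r.vars ⊆ U := fun z hz => hU (by simp [Block.vars, hz])
    have hb : b.vars ⊆ U := fun z hz => hU (by simp [Block.vars, hz])
    have hC : C.vars ⊆ U := fun z hz => hU (by simp [Block.vars, hz])
    have hs := ih Function.injective_id.injOn hr
    rw [Block.rename_id] at hs
    exact (Block.refines_ifThen ρ hC (ihb hf hb)).append (ih hf hr) hs
  | ifElse C b₁ b₂ r ih₁ ih₂ ih =>
    have hr : r.vars ⊆ U := fun z hz => hU (by simp [Block.vars, hz])
    have hb₁ : b₁.vars ⊆ U := fun z hz => hU (by simp [Block.vars, hz])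
    have hb₂ : b₂.vars ⊆ U := fun z hz => hU (by simp [Block.vars, hz])
    have hC : C.vars ⊆ U := fun z hz => hU (by simp [Block.vars, hz])
    have hs := ih Function.injective_id.injOn hr
    rw [Block.rename_id] at hs
    exact (Block.refines_ifElse ρ hC (ih₁ hf hb₁) (ih₂ hf hb₂)).append (ih hf hr) hs

/-- The effect of a statement list on the variables in `U` depends only on the values of these
variables. -/
theorem Block.refines_self (ρ : SymVal) {U : Finset Var} {b : Block} (hU : b.vars ⊆ U) :
    Block.Refines ρ U id id b b := by
  have h := Block.refines_rename ρ (f := id) Function.injective_id.injOn hU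
  rwa [Block.rename_id] at h

/-! ### Location and scale of the distributions -/

theorem map_add_mul_uniformLaw {a b : ℝ} (h : a < b) :
    (uniformLaw 0 1).map (fun r => a + (b - a) * r) = uniformLaw a b := by
  have hpos : 0 < b - a := sub_pos.2 h
  have hm : Measurable fun r : ℝ => a + (b - a) * r := by fun_prop
  ext E hE
  have hpre : (fun r : ℝ => a + (b - a) * r) ⁻¹' Set.Icc a b = Set.Icc 0 1 := by
    ext r
    simp only [Set.mem_preimage, Set.mem_Icc]
    constructor
    · rintro ⟨h1, h2⟩
      exact ⟨by nlinarith, by nlinarith⟩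
    · rintro ⟨h1, h2⟩
      exact ⟨by nlinarith, by nlinarith⟩
  have hvol : (volume : Measure ℝ) ((fun r : ℝ => a + (b - a) * r) ⁻¹' (E ∩ Set.Icc a b)) =
      ENNReal.ofReal (b - a)⁻¹ * volume (E ∩ Set.Icc a b) := by
    have e : (fun r : ℝ => a + (b - a) * r) = (fun r => a + r) ∘ fun r => (b - a) * r := rfl
    rw [e, Set.preimage_comp, Real.volume_preimage_mul_left hpos.ne', measure_preimage_add,
      abs_of_pos (inv_pos.2 hpos)]
  rw [Measure.map_apply hm hE]
  simp only [uniformLaw, Measure.smul_apply, smul_eq_mul, Measure.restrict_apply hE,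
    Measure.restrict_apply (hm hE)]
  rw [← hpre, ← Set.preimage_inter, hvol, ENNReal.ofReal_inv_of_pos hpos]
  simp

theorem map_add_laplaceLaw (m b : ℝ) :
    (laplaceLaw 0 b).map (fun r => m + r) = laplaceLaw m b := by
  have hm : Measurable fun r : ℝ => m + r := by fun_prop
  ext E hE
  rw [Measure.map_apply hm hE, laplaceLaw, laplaceLaw, withDensity_apply _ (hm hE),
    withDensity_apply _ hE, ← (measurePreserving_add_left volume m).setLIntegral_comp_preimage hE]
  · refine lintegral_congr fun r => ?_
    simp
  · fun_prop

theorem map_mul_expMeasure {c p : ℝ} (hc : 0 < c) (hp : 0 < p) :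
    (expMeasure c).map (fun r => p * r) = expMeasure (c / p) := by
  have hm : Measurable fun r : ℝ => p * r := by fun_prop
  have := isProbabilityMeasure_expMeasure hc
  have := isProbabilityMeasure_expMeasure (div_pos hc hp)
  have : IsProbabilityMeasure ((expMeasure c).map fun r => p * r) :=
    Measure.isProbabilityMeasure_map hm.aemeasurable
  refine Measure.eq_of_cdf _ _ ?_
  ext x
  rw [cdf_expMeasure_eq (div_pos hc hp), cdf_eq_real, map_measureReal_apply hm measurableSet_Iic]
  have hpre : (fun r : ℝ => p * r) ⁻¹' Set.Iic x = Set.Iic (x / p) := by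
    ext r
    simp [le_div_iff₀' hp]
  have h0 : 0 ≤ x / p ↔ 0 ≤ x := by
    rw [le_div_iff₀ hp, zero_mul]
  rw [hpre, ← cdf_eq_real, cdf_expMeasure_eq hc]
  simp only [h0, mul_div_assoc', div_mul_eq_mul_div]

/-- The two right-hand sides of the distribution transformation produce the given distribution. -/
theorem Rhs.law_of_distSplit {ρ : SymVal} {v w u : Rhs} {t : Var}
    (h : v.distSplit t = some (w, u)) (ht : t ∉ v.vars) {s : State} (hv : v.Valid ρ s) :
    ∃ q : Poly, u = .ofPoly q ∧ w.Valid ρ s ∧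
      (w.law ρ s).map (fun r => q.eval ρ (Function.update s t r)) = v.law ρ s := by
  -- The parameters of the draw do not depend on `t`.
  have hp : ∀ {p : Poly} (r : ℝ), p.vars ⊆ v.vars →
      p.eval ρ (Function.update s t r) = p.eval ρ s := fun {p} r hp =>
    Poly.eval_congr ρ fun z hz => Function.update_of_ne (by rintro rfl; exact ht (hp hz)) _ _
  cases v with
  | cat L p o => simp [Rhs.distSplit] at h
  | bernoulli p => simp [Rhs.distSplit] at h
  | exponential p => simp [Rhs.distSplit] at h
  | other k D args => simp [Rhs.distSplit] at h
  | normal p b =>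
    simp only [Rhs.distSplit] at h
    split_ifs at h
    simp only [Option.some.injEq, Prod.mk.injEq] at h
    obtain ⟨rfl, rfl⟩ := h
    have hw : (Rhs.normal .zero b).Valid ρ s := hv
    refine ⟨_, rfl, hw, ?_⟩
    rw [Rhs.law, Rhs.law, if_pos hv, if_pos hw]
    simp only [Poly.eval, Function.update_self, hp _ Finset.subset_union_left, Rhs.rawLaw,
      Poly.zero, Const.eval, Nat.cast_zero]
    rw [gaussianReal_map_const_add, zero_add]
  | uniform a b =>
    simp only [Rhs.distSplit] at h
    split_ifs at h
    simp only [Option.some.injEq, Prod.mk.injEq] at h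
    obtain ⟨rfl, rfl⟩ := h
    have hw : (Rhs.uniform .zero .one).Valid ρ s := by
      simp [Rhs.Valid, Poly.eval, Poly.zero, Poly.one, Const.eval]
    refine ⟨_, rfl, hw, ?_⟩
    rw [Rhs.law, Rhs.law, if_pos hv, if_pos hw]
    simp only [Poly.eval, Function.update_self, hp _ Finset.subset_union_left,
      hp _ Finset.subset_union_right, Rhs.rawLaw, Poly.zero, Poly.one, Const.eval, Nat.cast_zero,
      Nat.cast_one]
    exact map_add_mul_uniformLaw hv
  | laplace p b =>
    simp only [Rhs.distSplit] at h
    split_ifs at h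
    simp only [Option.some.injEq, Prod.mk.injEq] at h
    obtain ⟨rfl, rfl⟩ := h
    have hw : (Rhs.laplace .zero b).Valid ρ s := hv
    refine ⟨_, rfl, hw, ?_⟩
    rw [Rhs.law, Rhs.law, if_pos hv, if_pos hw]
    simp only [Poly.eval, Function.update_self, hp _ Finset.subset_union_left, Rhs.rawLaw,
      Poly.zero, Const.eval, Nat.cast_zero]
    exact map_add_laplaceLaw _ _
  | expQuot c p =>
    simp only [Rhs.distSplit, Option.some.injEq, Prod.mk.injEq] at h
    obtain ⟨rfl, rfl⟩ := h
    have hw : (Rhs.exponential (.const c)).Valid ρ s := hv.1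
    refine ⟨_, rfl, hw, ?_⟩
    rw [Rhs.law, Rhs.law, if_pos hv, if_pos hw]
    simp only [Poly.eval, Function.update_self, hp _ subset_rfl, Rhs.rawLaw]
    exact map_mul_expMeasure hv.1 hv.2

/-! ### The transformations preserve the semantics -/

theorem view_update_of_notMem {U : Finset Var} {t : Var} (ht : t ∉ U) (s : State) (r : ℝ) :
    view U id (Function.update s t r) = view U id s :=
  view_eq_view.2 fun z hz => Function.update_of_ne (by rintro rfl; exact ht hz) _ _

/-- If the condition does not hold, then the auxiliary assignment `t = w [C] t` leaves the state as
it is. -/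
theorem refines_dist (ρ : SymVal) {U : Finset Var} {x : Var} {v : Rhs} {C : BExp} {d t : Var}
    {w u : Rhs} (hU : (Block.assign x v C d .nil).vars ⊆ U) (ht : t ∉ U)
    (hsplit : v.distSplit t = some (w, u)) :
    Block.Refines ρ U id id (.assign x v C d .nil) (distNew t x w u C d) := by
  -- It suffices to compare the two statement lists when they are started in the same state.
  have key : ∀ s, (Block.assign x v C d .nil).Safe ρ s → (distNew t x w u C d).Safe ρ s ∧
      ((Block.assign x v C d .nil).kernel ρ s).map (view U id) =
        ((distNew t x w u C d).kernel ρ s).map (view U id) := by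
    have hvar : ∀ z, z = x ∨ z = d ∨ z ∈ v.vars ∨ z ∈ C.vars → z ≠ t := by
      rintro z hz rfl
      refine ht (hU ?_)
      simp only [Block.vars, Finset.mem_union, Finset.mem_insert, Finset.mem_singleton]
      tauto
    intro s hsafe
    have hC : ∀ r, C.Holds ρ (Function.update s t r) ↔ C.Holds ρ s := fun r =>
      BExp.holds_congr ρ fun z hz => Function.update_of_ne (hvar z (by tauto)) _ _
    rw [Block.safe_assign_nil] at hsafe
    rw [Block.kernel_assign_nil, distNew, Block.kernel_assign, Block.kernel_assign_nil, Block.Safe]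
    by_cases h : C.Holds ρ s
    · obtain ⟨q, rfl, hw, hlaw⟩ := Rhs.law_of_distSplit hsplit
        (fun h => hvar t (by tauto) rfl) (hsafe h)
      refine ⟨⟨fun _ => hw, ?_⟩, ?_⟩
      · refine Filter.Eventually.of_forall fun y => ?_
        rw [Block.safe_assign_nil]
        exact fun _ => Rhs.valid_ofPoly ρ q y
      · have hq : Measurable fun r => q.eval ρ (Function.update s t r) :=
          (q.measurable_eval ρ).comp (measurable_update s)
        rw [assignKernel_of_holds h, assignKernel_of_holds h, ← hlaw,
          Measure.map_map (measurable_update s) hq,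
          Measure.map_map (measurable_view U id) ((measurable_update s).comp hq),
          map_bind_kernel _ (measurable_update s)]
        ext E hE
        have hE' := measurable_view U id hE
        rw [Measure.map_apply ((measurable_view U id).comp ((measurable_update s).comp hq)) hE,
          Measure.map_apply (measurable_view U id) hE, Measure.bind_apply hE'
            ((assignKernel ρ x (.ofPoly q) C d).measurable.comp (measurable_update s)).aemeasurable,
          ← lintegral_indicator_one (((measurable_view U id).comp
            ((measurable_update s).comp hq)) hE)]
        refine lintegral_congr fun r => ?_
        have e : view U id (Function.update (Function.update s t r) x
            (q.eval ρ (Function.update s t r))) =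
            view U id (Function.update s x (q.eval ρ (Function.update s t r))) := by
          rw [Function.update_comm (hvar x (by tauto)).symm, view_update_of_notMem ht]
        rw [Function.comp_apply, assignKernel_of_holds ((hC r).2 h), Rhs.law_ofPoly,
          Measure.map_dirac' (measurable_update _), Measure.dirac_apply' _ hE']
        simp only [Set.indicator, Set.mem_preimage, Function.comp_apply, Pi.one_apply, e]
    · have hm := (Block.assign x u C d .nil).measurableSet_safe ρ
      rw [assignKernel_of_not_holds h, assignKernel_of_not_holds h, ae_dirac_iff hm,
        Block.safe_assign_nil, Function.update_eq_self, Measure.dirac_bind (Kernel.measurable _),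
        assignKernel_of_not_holds h]
      exact ⟨⟨fun h' => absurd h' h, fun h' => absurd h' h⟩, rfl⟩
  intro s s' hs hsafe
  obtain ⟨h1, h2⟩ := Block.refines_self ρ hU s s' hs hsafe
  obtain ⟨h3, h4⟩ := key s' h1
  exact ⟨h3, h2.trans h4⟩

/-- Copying: for each pair `(x, y)` in the list, in this order, `x` gets the value of `y`. -/
def copies : List (Var × Var) → State → State
  | [], s => s
  | (x, y) :: K, s => copies K (Function.update s x (s y))

theorem measurable_copies (K : List (Var × Var)) : Measurable (copies K) := by
  induction K with
  | nil => exact measurable_id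
  | cons c K ih => exact ih.comp (measurable_copy c.1 c.2)

theorem copies_apply_of_notMem {K : List (Var × Var)} {z : Var} (h : z ∉ K.map Prod.fst)
    (s : State) : copies K s z = s z := by
  induction K generalizing s with
  | nil => rfl
  | cons c K ih =>
    simp only [List.map_cons, List.mem_cons, not_or] at h
    rw [copies, ih h.2, Function.update_of_ne h.1]

/-- The plain assignments `x₁ = y₁; …; xₗ = yₗ` of variables. -/
def copyBlock (K : List (Var × Var)) : Block :=
  Block.assigns (K.map fun c => (c.1, Rhs.ofPoly (.var c.2)))

theorem copyBlock_append_kernel (ρ : SymVal) (K : List (Var × Var)) (r : Block) (s : State) :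
    ((copyBlock K).append r).kernel ρ s = r.kernel ρ (copies K s) := by
  induction K generalizing s with
  | nil => rfl
  | cons c K ih =>
    exact (Block.kernel_assign_ofPoly ρ c.1 (.var c.2) c.1 _ s).trans (ih _)

theorem copyBlock_append_safe (ρ : SymVal) (K : List (Var × Var)) (r : Block) (s : State) :
    ((copyBlock K).append r).Safe ρ s ↔ r.Safe ρ (copies K s) := by
  induction K generalizing s with
  | nil => rfl
  | cons c K ih => exact Block.safe_assign_ofPoly.trans (ih _)

/-- The draws of a simultaneous assignment, compared with draws into auxiliary variables `ts` that
are copied to the variables of the simultaneous assignment later on. The function `g` stands for the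
copying that belongs to earlier draws. -/
theorem map_drawsLaw_eq (ρ : SymVal) {U : Finset Var} (L : List (Var × Rhs))
    (hL : ∀ c ∈ L, c.1 ∈ U ∧ c.2.vars ⊆ U) (ts : List Var) (hlen : ts.length = L.length)
    (hnd : ts.Nodup) (hfr : ∀ t ∈ ts, t ∉ U) (g : State → State) (hgm : Measurable g)
    (hg : ∀ s, ∀ t ∈ ts, ∀ r, g (Function.update s t r) = Function.update (g s) t r)
    (s₀ s s' : State) (h₀ : view U id s₀ = view U id s') (h : view U id s = view U id (g s')) :
    (drawsLaw ρ L s₀ s).map (view U id) =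
      ((Block.assigns (ts.zip (L.map Prod.snd))).kernel ρ s').map
        (view U id ∘ copies ((L.map Prod.fst).zip ts) ∘ g) := by
  induction L generalizing ts g s s' with
  | nil =>
    obtain rfl := List.eq_nil_of_length_eq_zero hlen
    have hm : Measurable (view U id ∘ copies [] ∘ g) := (measurable_view U id).comp hgm
    simp only [List.map_nil, List.zip_nil_right, Block.assigns]
    rw [drawsLaw_nil, Block.kernel_nil, Measure.map_dirac' (measurable_view U id),
      Measure.map_dirac' hm, h]
    rfl
  | cons c L ih =>
    obtain ⟨x, v⟩ := c
    cases ts with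
    | nil => simp at hlen
    | cons t ts =>
      obtain ⟨hx, hv⟩ := hL (x, v) List.mem_cons_self
      obtain ⟨htn, hnd'⟩ := List.nodup_cons.1 hnd
      have htU : t ∉ U := hfr t List.mem_cons_self
      have hxt : x ≠ t := by rintro rfl; exact htU hx
      -- The copying that belongs to the draws up to and including the draw of `x`.
      let g' : State → State := fun s => Function.update (g s) x (g s t)
      have hg'm : Measurable g' := (measurable_copy x t).comp hgm
      have hm : Measurable (view U id ∘ copies ((L.map Prod.fst).zip ts) ∘ g') :=
        (measurable_view U id).comp ((measurable_copies _).comp hg'm)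
      have hg' : ∀ s, ∀ t' ∈ ts, ∀ r,
          g' (Function.update s t' r) = Function.update (g' s) t' r := by
        intro s t' ht' r
        have h1 : t ≠ t' := by rintro rfl; exact htn ht'
        have h2 : x ≠ t' := by rintro rfl; exact hfr x (List.mem_cons_of_mem _ ht') hx
        simp only [g', hg s t' (List.mem_cons_of_mem _ ht') r, Function.update_of_ne h1]
        rw [Function.update_comm h2]
      have hlaw : v.law ρ s₀ = v.law ρ s' := Rhs.law_congr ρ (eq_comp_of_view h₀ hv)
      change _ = ((Block.assign t v .tt t
        (Block.assigns (ts.zip (L.map Prod.snd)))).kernel ρ s').map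
        (view U id ∘ copies ((L.map Prod.fst).zip ts) ∘ g')
      rw [Block.kernel_assign, assignKernel_of_holds (by trivial),
        map_bind_kernel _ (measurable_update s')]
      ext E hE
      have h1 := measurable_view U id hE
      have h2 := hm hE
      rw [Measure.map_apply (measurable_view _ _) hE, drawsLaw_cons_apply _ _ _ _ _ _ h1,
        Measure.map_apply hm hE, Measure.bind_apply h2
          ((Kernel.measurable _).comp (measurable_update s')).aemeasurable, hlaw]
      refine lintegral_congr fun r => ?_
      rw [← Measure.map_apply (measurable_view _ _) hE, Function.comp_apply,
        ← Measure.map_apply hm hE]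
      refine congrArg (fun ν : Measure (U → ℝ) => ν E)
        (ih (fun c hc => hL c (List.mem_cons_of_mem _ hc)) ts (by simpa using hlen) hnd'
          (fun t ht => hfr t (List.mem_cons_of_mem _ ht)) g' hg'm hg' _ _ ?_ ?_)
      · rw [h₀, view_update_of_notMem htU]
      · have e : g' (Function.update s' t r) =
            Function.update (Function.update (g s') x r) t r := by
          simp only [g', hg s' t List.mem_cons_self r, Function.update_self]
          rw [Function.update_comm hxt]
        rw [e, view_update_of_notMem htU]
        refine view_eq_view.2 fun z hz => ?_
        by_cases hzx : z = x
        · simp [hzx]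
        · simp only [id, Function.update_of_ne hzx]
          exact view_eq_view.1 h z hz

/-- The auxiliary variables do not occur in the right-hand sides, so earlier draws do not change the
parameters of later ones. -/
theorem safe_assigns_zip (ρ : SymVal) {U : Finset Var} (ts : List Var) (hfr : ∀ t ∈ ts, t ∉ U)
    (vs : List Rhs) (hvs : ∀ v ∈ vs, v.vars ⊆ U) (s : State) (hs : ∀ v ∈ vs, v.Valid ρ s) :
    (Block.assigns (ts.zip vs)).Safe ρ s := by
  induction ts generalizing vs s with
  | nil => trivial
  | cons t ts ih =>
    cases vs with
    | nil => trivial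
    | cons v vs =>
      refine ⟨fun _ => hs v List.mem_cons_self, ?_⟩
      rw [assignKernel_of_holds (by trivial), ae_map_iff (measurable_update s).aemeasurable
        (Block.measurableSet_safe ρ _)]
      refine Filter.Eventually.of_forall fun r => ih (fun t ht => hfr t (List.mem_cons_of_mem _ ht))
        vs (fun v hv => hvs v (List.mem_cons_of_mem _ hv)) _ fun v' hv' => ?_
      refine (Rhs.valid_congr ρ fun z hz => ?_).2 (hs v' (List.mem_cons_of_mem _ hv'))
      refine Function.update_of_ne ?_ _ _
      rintro rfl
      exact hfr z List.mem_cons_self (hvs v' (List.mem_cons_of_mem _ hv') hz)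

theorem refines_sim (ρ : SymVal) {U : Finset Var} {L : List (Var × Rhs)} {ts : List Var}
    (hU : (Block.sim L .nil).vars ⊆ U) (hlen : ts.length = L.length) (hnd : ts.Nodup)
    (hfr : ∀ t ∈ ts, t ∉ U) :
    Block.Refines ρ U id id (.sim L .nil) (simNew ts L) := by
  have hL : ∀ c ∈ L, c.1 ∈ U ∧ c.2.vars ⊆ U := fun c hc =>
    ⟨hU ((Block.mem_vars_sim L _ _).2 (Or.inl ⟨c, hc, Or.inl rfl⟩)),
      fun z hz => hU ((Block.mem_vars_sim L _ z).2 (Or.inl ⟨c, hc, Or.inr hz⟩))⟩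
  have hcopy : Block.assigns ((L.map Prod.fst).zip (ts.map fun t => Rhs.ofPoly (.var t))) =
      copyBlock ((L.map Prod.fst).zip ts) := by
    rw [copyBlock, List.zip_map_right]
    rfl
  intro s s' hs hsafe
  have hvalid : ∀ v ∈ L.map Prod.snd, v.Valid ρ s' := by
    intro v hv
    obtain ⟨c, hc, rfl⟩ := List.mem_map.1 hv
    exact (Rhs.valid_congr ρ (eq_comp_of_view hs (hL c hc).2)).1 (hsafe.1 c hc)
  rw [simNew, hcopy]
  generalize hK : (L.map Prod.fst).zip ts = K
  have hker : ∀ y, (copyBlock K).kernel ρ y = Measure.dirac (copies K y) := fun y => by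
    have := copyBlock_append_kernel ρ K .nil y
    rwa [Block.append_nil, Block.kernel_nil] at this
  have hsafe' : ∀ y, (copyBlock K).Safe ρ y := fun y => by
    have := (copyBlock_append_safe ρ K .nil y).2 trivial
    rwa [Block.append_nil] at this
  refine ⟨?_, ?_⟩
  · rw [Block.safe_append]
    refine ⟨safe_assigns_zip ρ ts hfr _ (fun v hv => ?_) s' hvalid,
      Filter.Eventually.of_forall fun y => hsafe' y⟩
    obtain ⟨c, hc, rfl⟩ := List.mem_map.1 hv
    exact (hL c hc).2
  · rw [Block.kernel_append_apply, show ((copyBlock K).kernel ρ : State → Measure State) =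
        fun y => Measure.dirac (copies K y) from funext hker,
      Measure.bind_dirac_eq_map _ (measurable_copies K),
      Measure.map_map (measurable_view U id) (measurable_copies K), Block.kernel_sim_nil,
      simKernel_apply,
      map_drawsLaw_eq ρ L hL ts hlen hnd hfr id measurable_id (fun _ _ _ _ => rfl) s s s' hs hs, hK]
    rfl

/-- Statement lists that behave alike almost surely after `b` can be exchanged after `b`. -/
theorem Block.append_congr_ae (ρ : SymVal) {b r r' : Block} {s : State}
    (h : ∀ᵐ y ∂b.kernel ρ s, r.kernel ρ y = r'.kernel ρ y ∧ (r.Safe ρ y ↔ r'.Safe ρ y)) :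
    (b.append r).kernel ρ s = (b.append r').kernel ρ s ∧
      ((b.append r).Safe ρ s ↔ (b.append r').Safe ρ s) := by
  rw [Block.kernel_append_apply, Block.kernel_append_apply, Block.safe_append, Block.safe_append]
  refine ⟨Measure.bind_congr_right (h.mono fun y hy => hy.1), ?_⟩
  rw [Filter.eventually_congr (h.mono fun y hy => hy.2)]

/-- The auxiliary variables `t y` receive the original values, because no `t y` is one of the
variables to be copied. -/
theorem copies_apply_aux {xs : List Var} {t : Var → Var} (hinj : Set.InjOn t {y | y ∈ xs})
    (hnd : xs.Nodup) (hfr : ∀ y ∈ xs, ∀ z ∈ xs, t y ≠ z) (s : State) {y : Var} (hy : y ∈ xs) :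
    copies (xs.map fun y => (t y, y)) s (t y) = s y := by
  induction xs generalizing s with
  | nil => simp at hy
  | cons x xs ih =>
    obtain ⟨hx, hnd'⟩ := List.nodup_cons.1 hnd
    rw [List.map_cons, copies]
    by_cases hyx : y = x
    · subst hyx
      rw [copies_apply_of_notMem, Function.update_self]
      rw [List.map_map, List.mem_map]
      rintro ⟨z, hz, hzy⟩
      have := hinj (List.mem_cons_of_mem _ hz) hy hzy
      exact hx (this ▸ hz)
    · have hy' : y ∈ xs := List.mem_of_ne_of_mem hyx hy
      rw [ih (fun a ha b hb => hinj (List.mem_cons_of_mem _ ha) (List.mem_cons_of_mem _ hb)) hnd'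
        (fun a ha b hb => hfr a (List.mem_cons_of_mem _ ha) b (List.mem_cons_of_mem _ hb)) _ hy',
        Function.update_of_ne (hfr x List.mem_cons_self y hy).symm]

/-- If `C` holds, then `b₁` may change variables of `C`, but the renamed condition almost surely
still holds after `b₁`, so that `b₂` is skipped. -/
theorem refines_els (ρ : SymVal) {U : Finset Var} {C : BExp} {b₁ b₂ : Block} {xs : List Var}
    {t : Var → Var} (hU : (Block.ifElse C b₁ b₂ .nil).vars ⊆ U) (hnd : xs.Nodup)
    (hxs : ∀ y, y ∈ xs ↔ y ∈ C.vars ∧ y ∈ b₁.assigned) (hinj : Set.InjOn t {y | y ∈ xs})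
    (hfr : ∀ y ∈ xs, t y ∉ U) :
    Block.Refines ρ U id id (.ifElse C b₁ b₂ .nil) (elseNew xs t C b₁ b₂) := by
  have hC : C.vars ⊆ U := fun z hz => hU (by simp [Block.vars, hz])
  have hb₁ : b₁.vars ⊆ U := fun z hz => hU (by simp [Block.vars, hz])
  have hb₂ : b₂.vars ⊆ U := fun z hz => hU (by simp [Block.vars, hz])
  have hcopy : Block.assigns (xs.map fun y => (t y, Rhs.ofPoly (.var y))) =
      copyBlock (xs.map fun y => (t y, y)) := by
    rw [copyBlock, List.map_map]
    rfl
  intro s s' hs hsafe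
  rw [elseNew, hcopy, copyBlock_append_kernel, copyBlock_append_safe]
  set f : Var → Var := fun y => if y ∈ xs then t y else y with hf
  set s₁ := copies (xs.map fun y => (t y, y)) s' with hs₁
  have hview : view U id s = view U id s₁ := by
    rw [hs]
    refine view_eq_view.2 fun z hz => (copies_apply_of_notMem (fun h => ?_) _).symm
    rw [List.map_map, List.mem_map] at h
    obtain ⟨y, hy, rfl⟩ := h
    exact hfr y hy hz
  -- The auxiliary variables hold the values that the variables of the condition have in `s₁`.
  have haux : ∀ z ∈ C.vars, s₁ (f z) = s₁ z := by
    intro z hz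
    by_cases hzx : z ∈ xs
    · have h1 : s₁ z = s' z := ((view_eq_view.1 hview z (hC hz)).symm.trans
        (view_eq_view.1 hs z (hC hz)))
      rw [h1, hf]
      simp only [hzx, if_true]
      refine copies_apply_aux hinj hnd (fun a ha b hb e => hfr a ha ?_) s' hzx
      rw [e]
      exact hC ((hxs b).1 hb).1
    · simp [hf, hzx]
  have hCs : C.Holds ρ s ↔ C.Holds ρ s₁ := BExp.holds_congr ρ (eq_comp_of_view hview hC)
  by_cases h : C.Holds ρ s
  · -- After `b₁`, the renamed condition still has its old value.
    have hae : ∀ᵐ y ∂b₁.kernel ρ s₁,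
        (Block.ifThen (.not (C.rename f)) b₂ .nil).kernel ρ y = Block.nil.kernel ρ y ∧
        ((Block.ifThen (.not (C.rename f)) b₂ .nil).Safe ρ y ↔ Block.nil.Safe ρ y) := by
      filter_upwards [Block.ae_unchanged ρ b₁ s₁] with y hy
      have hCy : ¬ (BExp.not (C.rename f)).Holds ρ y := by
        rw [BExp.Holds, not_not, BExp.holds_rename]
        refine (BExp.holds_congr ρ fun z hz => ?_).1 (hCs.1 h)
        rw [Function.comp_apply, hy, haux z hz]
        by_cases hzx : z ∈ xs
        · simp only [hf, hzx, if_true]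
          exact fun h' => hfr z hzx (hb₁ (b₁.assigned_subset_vars h'))
        · simp only [hf, hzx, if_false]
          exact fun h' => hzx ((hxs z).2 ⟨hz, h'⟩)
      exact ⟨Block.kernel_ifThen_of_not_holds hCy, Block.safe_ifThen_of_not_holds hCy⟩
    obtain ⟨e1, e2⟩ := Block.append_congr_ae ρ hae
    rw [Block.append_nil] at e1 e2
    rw [Block.kernel_ifElse_of_holds h, Block.kernel_ifThen_of_holds (hCs.1 h),
      Block.safe_ifThen_of_holds (hCs.1 h), Block.append_nil, e1, e2]
    rw [Block.safe_ifElse_of_holds h, Block.append_nil] at hsafe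
    exact Block.refines_self ρ hb₁ s s₁ hview hsafe
  · have hCy : (BExp.not (C.rename f)).Holds ρ s₁ := by
      rw [BExp.Holds, BExp.holds_rename]
      exact fun h' => h (hCs.2 ((BExp.holds_congr ρ fun z hz => haux z hz).1 h'))
    rw [Block.kernel_ifElse_of_not_holds h, Block.kernel_ifThen_of_not_holds (mt hCs.2 h),
      Block.safe_ifThen_of_not_holds (mt hCs.2 h), Block.kernel_ifThen_of_holds hCy,
      Block.safe_ifThen_of_holds hCy, Block.append_nil]
    rw [Block.safe_ifElse_of_not_holds h, Block.append_nil] at hsafe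
    exact Block.refines_self ρ hb₂ s s₁ hview hsafe

/-- The if transformation without the assignment to the auxiliary variable, where the condition does
not change its value when `x` is replaced by `t`. -/
theorem ifNew_main (ρ : SymVal) {U : Finset Var} {t : Var} {C₁ : BExp} {x : Var} {v : Rhs}
    {C₂ : BExp} {rest tail : Block} (hU : (Block.ifThen C₁ (.assign x v C₂ x rest) .nil).vars ⊆ U)
    (ht : t ∉ U)
    (htail : tail = .ifThen (C₁.rename (sub x t)) rest .nil ∨ (tail = .nil ∧ rest = .nil))
    {s s₁ : State} (hview : view U id s = view U id s₁) (hst : x ∈ C₁.vars → s₁ t = s₁ x)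
    (hsafe : (Block.ifThen C₁ (.assign x v C₂ x rest) .nil).Safe ρ s) :
    (Block.assign x v (.and C₁ C₂) x tail).Safe ρ s₁ ∧
      ((Block.ifThen C₁ (.assign x v C₂ x rest) .nil).kernel ρ s).map (view U id) =
        ((Block.assign x v (.and C₁ C₂) x tail).kernel ρ s₁).map (view U id) := by
  have hC : C₁.vars ⊆ U := fun z hz => hU (by simp [Block.vars, hz])
  have hb : (Block.assign x v C₂ x rest).vars ⊆ U := fun z hz => hU (by
    rw [Block.vars]
    exact Finset.mem_union_left _ (Finset.mem_union_right _ hz))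
  have hxU : x ∈ U := hb (by simp [Block.vars])
  have hCs : C₁.Holds ρ s ↔ C₁.Holds ρ s₁ := BExp.holds_congr ρ (eq_comp_of_view hview hC)
  have hpos : ∀ y, (C₁.rename (sub x t)).Holds ρ y →
      tail.kernel ρ y = rest.kernel ρ y ∧ (tail.Safe ρ y ↔ rest.Safe ρ y) := by
    intro y hy
    rcases htail with rfl | ⟨rfl, rfl⟩
    · have e1 := Block.kernel_ifThen_of_holds (b := rest) (r := .nil) hy
      have e2 := Block.safe_ifThen_of_holds (b := rest) (r := .nil) hy
      rw [Block.append_nil] at e1 e2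
      exact ⟨e1, e2⟩
    · exact ⟨rfl, Iff.rfl⟩
  have hneg : ∀ y, ¬ (C₁.rename (sub x t)).Holds ρ y →
      tail.kernel ρ y = Block.nil.kernel ρ y ∧ tail.Safe ρ y := by
    intro y hy
    rcases htail with rfl | ⟨rfl, rfl⟩
    · exact ⟨Block.kernel_ifThen_of_not_holds hy, (Block.safe_ifThen_of_not_holds hy).2 trivial⟩
    · exact ⟨rfl, trivial⟩
  -- The renamed condition keeps the value that `C₁` has in `s₁` as long as only `x` changes.
  have hren : ∀ y, (∀ z ∉ ({x} : Finset Var), y z = s₁ z) →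
      ((C₁.rename (sub x t)).Holds ρ y ↔ C₁.Holds ρ s₁) := by
    intro y hy
    rw [BExp.holds_rename]
    refine BExp.holds_congr ρ fun z hz => ?_
    by_cases hzx : z = x
    · subst hzx
      have htz : t ≠ z := by rintro rfl; exact ht hxU
      simp only [Function.comp_apply, sub, if_true]
      rw [hy t (by simpa using htz), hst hz]
    · simp only [Function.comp_apply, sub, hzx, if_false]
      exact hy z (by simpa using hzx)
  by_cases h : C₁.Holds ρ s
  · have h₁ := hCs.1 h
    have hand : ∀ r : Block, (Block.assign x v (.and C₁ C₂) x r).kernel ρ s₁ =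
          (Block.assign x v C₂ x r).kernel ρ s₁ ∧
        ((Block.assign x v (.and C₁ C₂) x r).Safe ρ s₁ ↔
          (Block.assign x v C₂ x r).Safe ρ s₁) := by
      intro r
      have e : (BExp.and C₁ C₂).Holds ρ s₁ ↔ C₂.Holds ρ s₁ := and_iff_right h₁
      have ek : assignKernel ρ x v (.and C₁ C₂) x s₁ = assignKernel ρ x v C₂ x s₁ := by
        by_cases h₂ : C₂.Holds ρ s₁
        · rw [assignKernel_of_holds h₂, assignKernel_of_holds (e.2 h₂)]
        · rw [assignKernel_of_not_holds h₂, assignKernel_of_not_holds (mt e.1 h₂)]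
      rw [Block.kernel_assign, Block.kernel_assign, Block.Safe, Block.Safe, ek, e]
      exact ⟨rfl, Iff.rfl⟩
    have hae : ∀ᵐ y ∂(Block.assign x v C₂ x .nil).kernel ρ s₁,
        tail.kernel ρ y = rest.kernel ρ y ∧ (tail.Safe ρ y ↔ rest.Safe ρ y) := by
      rw [Block.kernel_assign_nil]
      filter_upwards [ae_assignKernel_unchanged ρ x v C₂ x s₁] with y hy
      exact hpos y ((hren y hy).2 h₁)
    obtain ⟨e1, e2⟩ := Block.append_congr_ae ρ hae
    simp only [Block.append] at e1 e2
    rw [Block.kernel_ifThen_of_holds h, Block.append_nil, (hand tail).1, (hand tail).2, e1, e2]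
    rw [Block.safe_ifThen_of_holds h, Block.append_nil] at hsafe
    exact Block.refines_self ρ hb s s₁ hview hsafe
  · have h₁ : ¬ C₁.Holds ρ s₁ := mt hCs.2 h
    have h₂ : ¬ (BExp.and C₁ C₂).Holds ρ s₁ := fun h' => h₁ h'.1
    obtain ⟨e1, e2⟩ := hneg s₁ (mt (hren s₁ fun _ _ => rfl).1 h₁)
    rw [Block.kernel_ifThen_of_not_holds h, Block.kernel_assign, Block.Safe,
      assignKernel_of_not_holds h₂, Function.update_eq_self,
      Measure.dirac_bind (Kernel.measurable _), ae_dirac_iff (tail.measurableSet_safe ρ), e1]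
    exact ⟨⟨fun h' => absurd h' h₂, e2⟩, (Block.Refines.nil ρ U id s s₁ hview trivial).2⟩

theorem refines_ite (ρ : SymVal) {U : Finset Var} {t : Var} {C₁ : BExp} {x : Var} {v : Rhs}
    {C₂ : BExp} {rest : Block} (hU : (Block.ifThen C₁ (.assign x v C₂ x rest) .nil).vars ⊆ U)
    (ht : t ∉ U) :
    Block.Refines ρ U id id (.ifThen C₁ (.assign x v C₂ x rest) .nil) (ifNew t C₁ x v C₂ rest) := by
  intro s s' hs hsafe
  have htx : t ≠ x := by
    rintro rfl
    exact ht (hU (by simp [Block.vars]))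
  have key : ∀ tail, (tail = .ifThen (C₁.rename (sub x t)) rest .nil ∨
      (tail = .nil ∧ rest = .nil)) → ∀ b', b' = (if x ∈ C₁.vars then
        .assign t (.ofPoly (.var x)) .tt t (.assign x v (.and C₁ C₂) x tail)
      else .assign x v (.and C₁ C₂) x tail : Block) →
      b'.Safe ρ s' ∧ ((Block.ifThen C₁ (.assign x v C₂ x rest) .nil).kernel ρ s).map (view U id) =
        (b'.kernel ρ s').map (view U id) := by
    rintro tail htail b' rfl
    split_ifs with hx
    · rw [Block.safe_assign_ofPoly, Block.kernel_assign_ofPoly]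
      refine ifNew_main ρ hU ht htail ?_ (fun _ => ?_) hsafe
      · rw [view_update_of_notMem ht, hs]
      · rw [Function.update_self, Function.update_of_ne htx.symm]
        rfl
    · exact ifNew_main ρ hU ht htail hs (fun h => absurd h hx) hsafe
  cases rest with
  | nil => exact key .nil (Or.inr ⟨rfl, rfl⟩) _ rfl
  | assign | sim | ifThen | ifElse => exact key _ (Or.inl rfl) _ rfl

theorem sub_self (x : Var) : sub x x = id := by
  funext z
  by_cases h : z = x <;> simp [sub, h]

/-- At the beginning the value of `x` is stored in `prev`, and after each assignment to an auxiliary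
variable in that one; the last assignment stores it in `x` again. -/
theorem refines_multi (ρ : SymVal) {U : Finset Var} (x : Var) (L : List (Var × Item)) (v : Rhs)
    (C : BExp) (d prev : Var) (hU : (multiOld x (L.map Prod.snd) v C d).vars ⊆ U)
    (hfr : ∀ y ∈ L.map Prod.fst, y ∉ U) :
    Block.Refines ρ U (sub x prev) id (multiOld x (L.map Prod.snd) v C d)
      (multiNew x prev L v C d) := by
  have hsub : ∀ {y z : Var}, z ≠ x → sub x y z = z := fun h => if_neg h
  induction L generalizing prev with
  | nil =>
    exact Block.refines_assign ρ hU rfl fun z _ hzx => by rw [hsub hzx]; exact ⟨rfl, hzx⟩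
  | cons i L ih =>
    obtain ⟨y, i⟩ := i
    have hy : y ∉ U := hfr y List.mem_cons_self
    simp only [List.map_cons, multiOld, multiNew] at hU ⊢
    have hU1 : (Block.assign x i.v i.C i.d .nil).vars ⊆ U := fun z hz => hU (by
      simp only [Block.vars, Finset.mem_union, Finset.notMem_empty, or_false] at hz ⊢
      tauto)
    have hU2 : (i.rest.append (multiOld x (L.map Prod.snd) v C d)).vars ⊆ U := fun z hz => hU (by
      rw [Block.vars]
      exact Finset.mem_union_right _ hz)
    have hU3 := hU2
    rw [Block.vars_append] at hU3
    have hU4 : i.rest.vars ⊆ U := Finset.subset_union_left.trans hU3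
    have hU5 : (multiOld x (L.map Prod.snd) v C d).vars ⊆ U := Finset.subset_union_right.trans hU3
    have hinj : Set.InjOn (sub x y) U := by
      intro a ha b hb hab
      have hay : a ≠ y := by rintro rfl; exact hy ha
      have hby : b ≠ y := by rintro rfl; exact hy hb
      by_cases h1 : a = x <;> by_cases h2 : b = x <;>
        simp only [sub, h1, h2, if_true, if_false] at hab
      · rw [h1, h2]
      · exact absurd hab.symm hby
      · exact absurd hab hay
      · exact hab
    have r1 : Block.Refines ρ U (sub x prev) (sub x y) (.assign x i.v i.C i.d .nil)
        (.assign y (i.v.rename (sub x prev)) (i.C.rename (sub x prev)) (sub x prev i.d) .nil) := by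
      refine Block.refines_assign ρ hU1 (if_pos rfl) fun z hz hzx => ?_
      rw [hsub hzx, hsub hzx]
      exact ⟨rfl, by rintro rfl; exact hy hz⟩
    have r2 := (Block.refines_rename ρ hinj hU4).append
      (ih y hU5 fun z hz => hfr z (List.mem_cons_of_mem _ hz)) (Block.refines_self ρ hU5)
    exact r1.append r2 (Block.refines_self ρ hU2)

theorem Rule.refines (ρ : SymVal) {U : Finset Var} {b b' : Block} (h : Rule U b b')
    (hU : b.vars ⊆ U) : Block.Refines ρ U id id b b' := by
  cases h with
  | sim L ts hlen hnd hfr => exact refines_sim ρ hU hlen hnd hfr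
  | dist x v C d t w u ht hsplit => exact refines_dist ρ hU ht hsplit
  | els C b₁ b₂ xs t hnd hxs hinj hfr => exact refines_els ρ hU hnd hxs hinj hfr
  | ite C₁ x v C₂ rest t ht => exact refines_ite ρ hU ht
  | multi x L v C d hL hnd hfr =>
    have := refines_multi ρ x L v C d x hU hfr
    rwa [sub_self] at this

theorem BlockStep.refines (ρ : SymVal) {U : Finset Var} {b b' : Block} (h : BlockStep U b b')
    (hU : b.vars ⊆ U) : Block.Refines ρ U id id b b' := by
  -- Every statement list is the concatenation of its first statement and the rest.
  have split : ∀ {a r : Block}, (a.append r).vars ⊆ U → a.vars ⊆ U ∧ r.vars ⊆ U := by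
    intro a r h
    rw [Block.vars_append] at h
    exact ⟨Finset.subset_union_left.trans h, Finset.subset_union_right.trans h⟩
  induction h with
  | here post h =>
    obtain ⟨h1, h2⟩ := split hU
    have hs := Block.refines_self ρ h2
    exact (h.refines ρ h1).append hs hs
  | assign x v C d h ih =>
    obtain ⟨h1, h2⟩ := split (a := .assign x v C d .nil) hU
    exact (Block.refines_self ρ h1).append (ih h2) (Block.refines_self ρ h2)
  | sim L h ih =>
    obtain ⟨h1, h2⟩ := split (a := .sim L .nil) hU
    exact (Block.refines_self ρ h1).append (ih h2) (Block.refines_self ρ h2)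
  | @ifThenBranch C b b' r h ih =>
    obtain ⟨h1, h2⟩ := split (a := .ifThen C b .nil) hU
    have hs := Block.refines_self ρ h2
    have hC : C.vars ⊆ U := fun z hz => h1 (by simp [Block.vars, hz])
    have hb : b.vars ⊆ U := fun z hz => h1 (by simp [Block.vars, hz])
    have key := Block.refines_ifThen ρ hC (ih hb)
    rw [BExp.rename_id] at key
    exact key.append hs hs
  | ifThenTail C b h ih =>
    obtain ⟨h1, h2⟩ := split (a := .ifThen C b .nil) hU
    exact (Block.refines_self ρ h1).append (ih h2) (Block.refines_self ρ h2)
  | @ifElseLeft C b b' b₂ r h ih =>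
    obtain ⟨h1, h2⟩ := split (a := .ifElse C b b₂ .nil) hU
    have hs := Block.refines_self ρ h2
    have hC : C.vars ⊆ U := fun z hz => h1 (by simp [Block.vars, hz])
    have hb : b.vars ⊆ U := fun z hz => h1 (by simp [Block.vars, hz])
    have hb₂ : b₂.vars ⊆ U := fun z hz => h1 (by simp [Block.vars, hz])
    have key := Block.refines_ifElse ρ hC (ih hb) (Block.refines_self ρ hb₂)
    rw [BExp.rename_id] at key
    exact key.append hs hs
  | @ifElseRight C b₁ b b' r h ih =>
    obtain ⟨h1, h2⟩ := split (a := .ifElse C b₁ b .nil) hU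
    have hs := Block.refines_self ρ h2
    have hC : C.vars ⊆ U := fun z hz => h1 (by simp [Block.vars, hz])
    have hb : b.vars ⊆ U := fun z hz => h1 (by simp [Block.vars, hz])
    have hb₁ : b₁.vars ⊆ U := fun z hz => h1 (by simp [Block.vars, hz])
    have key := Block.refines_ifElse ρ hC (Block.refines_self ρ hb₁) (ih hb)
    rw [BExp.rename_id] at key
    exact key.append hs hs
  | ifElseTail C b₁ b₂ h ih =>
    obtain ⟨h1, h2⟩ := split (a := .ifElse C b₁ b₂ .nil) hU
    exact (Block.refines_self ρ h1).append (ih h2) (Block.refines_self ρ h2)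

end Semantics

/-! ### The Markov chain -/

instance (P : Program) (ρ : SymVal) (σ : State) : IsProbabilityMeasure (P.runMeasure ρ σ) := by
  unfold Program.runMeasure
  infer_instance

open Preorder in
theorem Program.map_runMeasure_zero (P : Program) (ρ : SymVal) (σ : State) :
    (P.runMeasure ρ σ).map (frestrictLe (π := fun _ : ℕ => State) 0) =
      (P.init.kernel ρ σ).map fun s _ => s := by
  rw [Program.runMeasure, Kernel.trajMeasure, Measure.map_comp _ _ (by fun_prop),
    Kernel.traj_map_frestrictLe, Kernel.partialTraj_self, Measure.id_comp]
  rfl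

/-- The transition kernel of a program, as a kernel from histories up to time `n`. -/
noncomputable def Program.histKernel (P : Program) (ρ : SymVal) (n : ℕ) :
    Kernel ((i : Finset.Iic n) → State) State :=
  (P.body.kernel ρ).comap
    (fun h : (i : Finset.Iic n) → State => h ⟨n, Finset.mem_Iic.2 le_rfl⟩) (measurable_pi_apply _)

instance (P : Program) (ρ : SymVal) (n : ℕ) : IsMarkovKernel (P.histKernel ρ n) := by
  unfold Program.histKernel
  infer_instance

open Preorder in
/-- The Markov property: the joint law of the history up to time `n` and the next state. -/
theorem Program.map_runMeasure_succ (P : Program) (ρ : SymVal) (σ : State) (n : ℕ) :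
    (P.runMeasure ρ σ).map (fun ω => (frestrictLe (π := fun _ : ℕ => State) n ω, ω (n + 1))) =
      ((P.runMeasure ρ σ).map (frestrictLe (π := fun _ : ℕ => State) n)).bind
        (Kernel.id ×ₖ P.histKernel ρ n : Kernel _ (((i : Finset.Iic n) → State) × State)) := by
  have h := Kernel.map_frestrictLe_trajMeasure_compProd_eq_map_trajMeasure
    (X := fun _ => State) (μ₀ := P.init.kernel ρ σ) (κ := fun n => P.histKernel ρ n) (a := n)
  rw [Measure.compProd_eq_comp_prod] at h
  exact h.symm

/-- The values of the variables in `U` at all times of a history. -/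
def histView (U : Finset Var) (n : ℕ) (h : (i : Finset.Iic n) → State) :
    (i : Finset.Iic n) → U → ℝ := fun i => view U id (h i)

theorem measurable_histView (U : Finset Var) (n : ℕ) : Measurable (histView U n) :=
  measurable_pi_lambda _ fun i => (measurable_view U id).comp (measurable_pi_apply i)

open Preorder in
/-- If the two parts of `Q` refine those of `P`, then, as far as the variables in `U` are concerned,
the histories of `P` and `Q` up to time `n` have the same law. Moreover, the next iteration of `Q` is
almost surely safe. -/
theorem Program.map_histView_eq {ρ : SymVal} {σ : State} {U : Finset Var} {P Q : Program}
    (hi : Block.Refines ρ U id id P.init Q.init) (hb : Block.Refines ρ U id id P.body Q.body)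
    (hself : Block.Refines ρ U id id P.body P.body) (hadm : P.Admissible ρ σ) (n : ℕ) :
    ((P.runMeasure ρ σ).map (frestrictLe (π := fun _ : ℕ => State) n)).map (histView U n) =
      ((Q.runMeasure ρ σ).map (frestrictLe (π := fun _ : ℕ => State) n)).map (histView U n) ∧
    ∀ᵐ ω ∂Q.runMeasure ρ σ, Q.body.Safe ρ (ω n) := by
  -- One step of the induction: equality of laws at time `n` is all that is needed to pass to the
  -- joint law of the history and the next state.
  have step : ∀ n, ((P.runMeasure ρ σ).map (frestrictLe (π := fun _ : ℕ => State) n)).map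
        (histView U n) =
      ((Q.runMeasure ρ σ).map (frestrictLe (π := fun _ : ℕ => State) n)).map (histView U n) →
      (∀ᵐ ω ∂Q.runMeasure ρ σ, Q.body.Safe ρ (ω n)) ∧
      ((P.runMeasure ρ σ).map fun ω => (frestrictLe (π := fun _ : ℕ => State) n ω, ω (n + 1))).map
        (Prod.map (histView U n) (view U id)) =
      ((Q.runMeasure ρ σ).map fun ω => (frestrictLe (π := fun _ : ℕ => State) n ω, ω (n + 1))).map
        (Prod.map (histView U n) (view U id)) := by
    intro n hn
    have hm : Measurable (Prod.map (histView U n) (view U id)) :=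
      (measurable_histView U n).prodMap (measurable_view U id)
    have hsec : Measurable fun (a : (i : Finset.Iic n) → U → ℝ) (i : Finset.Iic n) =>
        extend U (a i) :=
      measurable_pi_lambda _ fun i => (measurable_extend U).comp (measurable_pi_apply i)
    -- The law of the next step from a given history, as seen through `U`.
    have hker : ∀ (R : Program) (h : (i : Finset.Iic n) → State),
        ((Kernel.id ×ₖ R.histKernel ρ n : Kernel _ (((i : Finset.Iic n) → State) × State)) h).map
          (Prod.map (histView U n) (view U id)) = (Measure.dirac (histView U n h)).prod
            ((R.body.kernel ρ (h ⟨n, Finset.mem_Iic.2 le_rfl⟩)).map (view U id)) := by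
      intro R h
      rw [Kernel.prod_apply, ← Measure.map_prod_map _ _ (measurable_histView U n)
        (measurable_view U id), Kernel.id_apply, Measure.map_dirac' (measurable_histView U n)]
      rfl
    have hstep : ∀ R : Program, Block.Refines ρ U id id P.body R.body →
        ∀ h h' : (i : Finset.Iic n) → State, histView U n h = histView U n h' →
          P.body.Safe ρ (h ⟨n, Finset.mem_Iic.2 le_rfl⟩) →
          R.body.Safe ρ (h' ⟨n, Finset.mem_Iic.2 le_rfl⟩) ∧
          ((Kernel.id ×ₖ P.histKernel ρ n : Kernel _ (((i : Finset.Iic n) → State) × State)) h).map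
            (Prod.map (histView U n) (view U id)) =
          ((Kernel.id ×ₖ R.histKernel ρ n : Kernel _ (((i : Finset.Iic n) → State) × State)) h').map
            (Prod.map (histView U n) (view U id)) := by
      intro R hR h h' hh hs
      obtain ⟨h1, h2⟩ := hR _ _ (congrFun hh ⟨n, Finset.mem_Iic.2 le_rfl⟩) hs
      refine ⟨h1, ?_⟩
      rw [hker, hker, hh, h2]
    have hQm : MeasurableSet {h : (i : Finset.Iic n) → State |
        P.body.Safe ρ (h ⟨n, Finset.mem_Iic.2 le_rfl⟩)} :=
      measurable_pi_apply (⟨n, Finset.mem_Iic.2 le_rfl⟩ : Finset.Iic n)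
        (P.body.measurableSet_safe ρ)
    have hsafe : ∀ᵐ h ∂(P.runMeasure ρ σ).map (frestrictLe (π := fun _ : ℕ => State) n),
        P.body.Safe ρ (h ⟨n, Finset.mem_Iic.2 le_rfl⟩) :=
      (ae_map_iff (measurable_frestrictLe n).aemeasurable hQm).2 (hadm.2.mono fun ω hω => hω n)
    obtain ⟨h1, h2⟩ := bind_transfer (measurable_histView U n) (measurable_histView U n) hm hm hsec
      (fun a => funext fun i => view_extend U (a i)) hn
      (Kernel.id ×ₖ P.histKernel ρ n : Kernel _ (((i : Finset.Iic n) → State) × State))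
      (Kernel.id ×ₖ Q.histKernel ρ n : Kernel _ (((i : Finset.Iic n) → State) × State))
      hQm (hstep P hself) (hstep Q hb) hsafe
    rw [Program.map_runMeasure_succ, Program.map_runMeasure_succ]
    exact ⟨ae_of_ae_map (measurable_frestrictLe n).aemeasurable h1, h2⟩
  suffices h : ∀ n, ((P.runMeasure ρ σ).map (frestrictLe (π := fun _ : ℕ => State) n)).map
        (histView U n) =
      ((Q.runMeasure ρ σ).map (frestrictLe (π := fun _ : ℕ => State) n)).map (histView U n) from
    ⟨h n, (step n (h n)).1⟩
  intro n
  induction n with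
  | zero =>
    have hc : Measurable fun (s : State) (_ : Finset.Iic 0) => s := by fun_prop
    have hc' : Measurable fun (u : U → ℝ) (_ : Finset.Iic 0) => u := by fun_prop
    have e : ∀ R : Program, ((R.runMeasure ρ σ).map
        (frestrictLe (π := fun _ : ℕ => State) 0)).map (histView U 0) =
        ((R.init.kernel ρ σ).map (view U id)).map fun u _ => u := by
      intro R
      rw [Program.map_runMeasure_zero, Measure.map_map (measurable_histView U 0) hc,
        Measure.map_map hc' (measurable_view U id)]
      rfl
    rw [e, e, (hi σ σ rfl hadm.1).2]
  | succ n ih =>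
    -- The history up to time `n + 1` consists of the history up to time `n` and the last state.
    let glue : ((i : Finset.Iic n) → U → ℝ) × (U → ℝ) → (i : Finset.Iic (n + 1)) → U → ℝ :=
      fun q i => if h : i.1 ∈ Finset.Iic n then q.1 ⟨i.1, h⟩ else q.2
    have hglue : Measurable glue := by
      refine measurable_pi_lambda _ fun i => ?_
      by_cases h : i.1 ∈ Finset.Iic n
      · simp only [glue, h, dif_pos]
        fun_prop
      · simp only [glue, h, dif_neg, not_false_eq_true]
        fun_prop
    have e : ∀ R : Program, ((R.runMeasure ρ σ).map
        (frestrictLe (π := fun _ : ℕ => State) (n + 1))).map (histView U (n + 1)) =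
        (((R.runMeasure ρ σ).map
          fun ω => (frestrictLe (π := fun _ : ℕ => State) n ω, ω (n + 1))).map
            (Prod.map (histView U n) (view U id))).map glue := by
      intro R
      have h1 : Measurable fun ω : ℕ → State =>
          (frestrictLe (π := fun _ : ℕ => State) n ω, ω (n + 1)) :=
        (measurable_frestrictLe n).prodMk (measurable_pi_apply _)
      have h2 : Measurable (Prod.map (histView U n) (view U id)) :=
        (measurable_histView U n).prodMap (measurable_view U id)
      rw [Measure.map_map (measurable_histView U _) (measurable_frestrictLe _),
        Measure.map_map h2 h1, Measure.map_map hglue (h2.comp h1)]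
      congr 1
      funext ω i
      by_cases h : i.1 ∈ Finset.Iic n
      · simp only [Function.comp_apply, glue, h, dif_pos]
        rfl
      · have hi : i.1 = n + 1 := by
          have h1 := Finset.mem_Iic.1 i.2
          have h2 := mt Finset.mem_Iic.2 h
          omega
        simp only [Function.comp_apply, glue, Prod.map, histView, frestrictLe_apply, hi,
          dite_eq_ite, ite_self]
    rw [e, e, (step n ih).2]

open Preorder in
theorem Program.jointLaw_eq {ρ : SymVal} {σ : State} {U X : Finset Var} {P Q : Program}
    (hX : X ⊆ U)
    (h : ∀ n, ((P.runMeasure ρ σ).map (frestrictLe (π := fun _ : ℕ => State) n)).map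
        (histView U n) =
      ((Q.runMeasure ρ σ).map (frestrictLe (π := fun _ : ℕ => State) n)).map (histView U n)) :
    P.jointLaw ρ σ X = Q.jointLaw ρ σ X := by
  have hm : Measurable fun (ω : ℕ → State) (n : ℕ) (x : X) => ω n x := by fun_prop
  have hP : ∀ R : Program, IsProbabilityMeasure (R.jointLaw ρ σ X) := fun R =>
    Measure.isProbabilityMeasure_map hm.aemeasurable
  -- Restrictions to finitely many times factor through the histories.
  have e : ∀ (R : Program) (I : Finset ℕ), (R.jointLaw ρ σ X).map I.restrict =
      (((R.runMeasure ρ σ).map (frestrictLe (π := fun _ : ℕ => State) (I.sup id))).map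
        (histView U (I.sup id))).map fun a (i : I) (x : X) =>
          a ⟨i.1, Finset.mem_Iic.2 (Finset.le_sup (f := id) i.2)⟩ ⟨x.1, hX x.2⟩ := by
    intro R I
    rw [Program.jointLaw, Measure.map_map (by fun_prop) hm,
      Measure.map_map (measurable_histView U _) (measurable_frestrictLe _),
      Measure.map_map (by fun_prop) ((measurable_histView U _).comp (measurable_frestrictLe _))]
    rfl
  have := hP P
  have hfin : ∀ I : Finset ℕ, IsFiniteMeasure ((P.jointLaw ρ σ X).map I.restrict) := fun I =>
    inferInstance
  refine IsProjectiveLimit.unique (P := fun I : Finset ℕ => (P.jointLaw ρ σ X).map I.restrict)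
    (fun I => rfl) fun I => ?_
  change (Q.jointLaw ρ σ X).map I.restrict = (P.jointLaw ρ σ X).map I.restrict
  rw [e, e, h]

theorem Program.Step.equivOn {P Q : Program} (h : P.Step Q) : P.EquivOn P.Vars Q := by
  have hi : P.init.vars ⊆ P.allVars := Finset.subset_union_left
  have hb : P.body.vars ⊆ P.allVars := Finset.subset_union_right
  have hX : P.Vars ⊆ P.allVars := P.body.assigned_subset_vars.trans hb
  have hV : P.Vars ⊆ Q.Vars := by
    cases h with
    | init h => exact subset_rfl
    | body h => exact h.progress.assigned_subset
  refine ⟨Finset.subset_inter subset_rfl hV, fun ρ σ hadm => ?_⟩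
  have hri : Block.Refines ρ P.allVars id id P.init Q.init := by
    cases h with
    | init h => exact h.refines ρ hi
    | body h => exact Block.refines_self ρ hi
  have hrb : Block.Refines ρ P.allVars id id P.body Q.body := by
    cases h with
    | init h => exact Block.refines_self ρ hb
    | body h => exact h.refines ρ hb
  have key := Program.map_histView_eq hri hrb (Block.refines_self ρ hb) hadm
  exact ⟨⟨(hri σ σ rfl hadm.1).1, ae_all_iff.2 fun n => (key n).2⟩,
    Program.jointLaw_eq hX fun n => (key n).1⟩

theorem Program.jointLaw_mono {ρ : SymVal} {σ : State} {X Y : Finset Var} {P Q : Program}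
    (hXY : X ⊆ Y) (h : P.jointLaw ρ σ Y = Q.jointLaw ρ σ Y) :
    P.jointLaw ρ σ X = Q.jointLaw ρ σ X := by
  have e : ∀ R : Program, R.jointLaw ρ σ X =
      (R.jointLaw ρ σ Y).map fun a n (x : X) => a n ⟨x.1, hXY x.2⟩ := by
    intro R
    rw [Program.jointLaw, Program.jointLaw, Measure.map_map (by fun_prop) (by fun_prop)]
    rfl
  rw [e, e, h]

theorem Program.equivOn_of_steps {P Q : Program} (h : Relation.ReflTransGen Program.Step P Q) :
    P.EquivOn P.Vars Q := by
  induction h with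
  | refl => exact ⟨by rw [Finset.inter_self], fun ρ σ hadm => ⟨hadm, rfl⟩⟩
  | tail h hs ih =>
    obtain ⟨h1, h2⟩ := ih
    obtain ⟨h3, h4⟩ := hs.equivOn
    have h1' := h1.trans Finset.inter_subset_right
    have h3' := h3.trans Finset.inter_subset_right
    refine ⟨Finset.subset_inter subset_rfl (h1'.trans h3'), fun ρ σ hadm => ?_⟩
    obtain ⟨h5, h6⟩ := h2 ρ σ hadm
    obtain ⟨h7, h8⟩ := h4 ρ σ h5
    exact ⟨h7, h6.trans (Program.jointLaw_mono h1' h8)⟩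

end ProbLoop


theorem theorem3p1 :
    -- The procedure `next` applies a transformation whenever one is applicable.
    (∀ P Q : ProbLoop.Program, P.next = some Q → P.Step Q) ∧
    (∀ P : ProbLoop.Program, P.next = none ↔ P.NormalForm) ∧
    ∀ P : ProbLoop.Program,
      -- Iterating it ends in an equivalent normal form.
      (∃ (k : ℕ) (N : ProbLoop.Program),
        ((fun Q : ProbLoop.Program => Q.next.getD Q)^[k]) P = N ∧
        Relation.ReflTransGen ProbLoop.Program.Step P N ∧ N.NormalForm ∧
        P.EquivOn P.Vars N) ∧
      -- The transformations cannot be applied forever, in whatever order.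
      (¬ ∃ f : ℕ → ProbLoop.Program, f 0 = P ∧ ∀ n, (f n).Step (f (n + 1))) ∧
      -- Every program on the way is equivalent.
      (∀ Q : ProbLoop.Program, Relation.ReflTransGen ProbLoop.Program.Step P Q →
        P.EquivOn P.Vars Q) := by
  refine ⟨fun P Q => ProbLoop.Program.step_of_next, ProbLoop.Program.next_eq_none_iff, fun P =>
    ⟨?_, P.not_exists_infinite_steps, fun Q => ProbLoop.Program.equivOn_of_steps⟩⟩
  obtain ⟨k, h1, h2⟩ := P.exists_iterate_next
  exact ⟨k, _, rfl, h1, h2, ProbLoop.Program.equivOn_of_steps h1⟩
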